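/- Let $M\ge 1$ and $d_1,\dots,d_M\in\mathbb{N}$, write $\mathcal{X}_m=\mathbb{R}^{d_m}$ with its Euclidean norm, $\mathcal{X}=\mathcal{X}_1\times\dots\times\mathcal{X}_M=\mathbb{R}^d$, and for $x\in\mathcal{X}$ let $x_{-m}$ be the vector of all blocks of $x$ except $x_m$. Let $\pi(\mathrm{d}x)=e^{-U(x)}\,\mathrm{d}x$ be a probability measure on $\mathcal{X}$ whose potential $U:\mathcal{X}\to\mathbb{R}$ decomposes as $$U(x)=U_0(x)+\sum_{m=1}^M U_m(x_m),$$ where every $U_m:\mathbb{R}^{d_m}\to\mathbb{R}$ is convex, $U_0$ is of class $C^1$, and there are constants $L_1,\dots,L_M>0$ and $\lambda^*>0$ such that (i) for every $m$ and every $\bar x_{-m}$, the map $x_m\mapsto\nabla_m U_0(x_m,\bar x_{-m})$ is $L_m$-Lipschitz; (ii) $x\mapsto U_0(x)-\frac{\lambda^*}{2}\sum_{m=1}^M L_m\|x_m\|^2$ is convex. Put $\kappa^*=1/\lambda^*$. Let $\pi(\cdot|x_{-m})$ be the conditional distribution on $\mathcal{X}_m$ with density proportional to $y_m\mapsto e^{-U(y_m,x_{-m})}$.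 For every $m$ let $(\bar P_m^{x_{-m}})_{x_{-m}}$ be a family of Markov kernels on $\mathcal{X}_m$, jointly measurable in $(x_{-m},x_m)$, such that $\bar P_m^{x_{-m}}$ is $\pi(\cdot|x_{-m})$-reversible for every $x_{-m}$. Define the Metropolis-within-Gibbs kernel on $\mathcal{X}$ by $$P^{\mathrm{MwG}}=\frac1M\sum_{m=1}^M\bar P_m,\qquad \bar P_m(x,A)=\int_{\mathcal{X}_m}\mathbf{1}_A(y_m,x_{-m})\,\bar P_m^{x_{-m}}(x_m,\mathrm{d}y_m).$$ Let $\beta\in\mathbb{R}$ be such that $$\mathrm{KL}\big(\nu\bar P_m^{x_{-m}}\,\big|\,\pi(\cdot|x_{-m})\big)\le(1-\beta)\,\mathrm{KL}\big(\nu\,\big|\,\pi(\cdot|x_{-m})\big)$$ for all $m\in\{1,\dots,M\}$, all $x\in\mathcal{X}$ and all probability measures $\nu$ on $\mathcal{X}_m$ with $\mathrm{KL}(\nu|\pi(\cdot|x_{-m}))<\infty$. Then for every probability measure $\mu$ on $\mathcal{X}$ with $\mathrm{KL}(\mu|\pi)<\infty$, $$\mathrm{KL}(\mu P^{\mathrm{MwG}}|\pi)\le\Big(1-\frac{\beta}{\kappa^*M}\Big)\mathrm{KL}(\mu|\pi).$$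 -/

import Mathlib

open MeasureTheory ProbabilityTheory InformationTheory
open scoped ENNReal

namespace MwG

/-- The `m`-th block `𝒳_m = ℝ^{d_m}`, with its Euclidean norm. -/
abbrev Block {M : ℕ} (d : Fin M → ℕ) (m : Fin M) : Type :=
  EuclideanSpace ℝ (Fin (d m))

/-- The state space `𝒳 = 𝒳_1 × ⋯ × 𝒳_M`, with the product σ-algebra and Lebesgue measure. -/
abbrev State {M : ℕ} (d : Fin M → ℕ) : Type :=
  ∀ m : Fin M, Block d m

/-- The product `𝒳_{-m}` of all blocks except the `m`-th one. -/
abbrev Rest {M : ℕ} (d : Fin M → ℕ) (m : Fin M) : Type :=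
  ∀ i : {i : Fin M // i ≠ m}, Block d i.1

/-- The point `x_{-m}`. -/
def rest {M : ℕ} {d : Fin M → ℕ} (m : Fin M) (x : State d) : Rest d m :=
  fun i => x i.1

/-- The measure `exp(-U(x)) dx`. -/
noncomputable def gibbs {M : ℕ} {d : Fin M → ℕ} (U : State d → ℝ) : Measure (State d) :=
  (volume : Measure (State d)).withDensity fun x => ENNReal.ofReal (Real.exp (-U x))

/-- The conditional distribution `π(· | x_{-m})` on `𝒳_m`, for `π = exp(-U)`: the measure with
density proportional to `y ↦ exp(-U(y, x_{-m}))`. It does not depend on `x m`. -/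
noncomputable def fullConditional {M : ℕ} {d : Fin M → ℕ} (U : State d → ℝ) (m : Fin M)
    (x : State d) : Measure (Block d m) :=
  (∫⁻ y : Block d m, ENNReal.ofReal (Real.exp (-U (Function.update x m y))))⁻¹ •
    (volume : Measure (Block d m)).withDensity
      fun y => ENNReal.ofReal (Real.exp (-U (Function.update x m y)))

/-- `U = U₀ + ∑ m, U_m(x_m)` with `U_m` convex and `U₀` of class `C¹`, block-wise smooth with
constants `L m > 0`, and `lam`-convex (`lam > 0`) for the distance `‖x‖_L² = ∑ m, L m ‖x_m‖²`. -/
structure BlockConvexSmooth {M : ℕ} {d : Fin M → ℕ} (U U₀ : State d → ℝ)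
    (V : ∀ m, Block d m → ℝ) (L : Fin M → ℝ) (lam : ℝ) : Prop where
  decomp : ∀ x, U x = U₀ x + ∑ m, V m (x m)
  convex_sep : ∀ m, ConvexOn ℝ Set.univ (V m)
  contDiff : ContDiff ℝ 1 U₀
  L_pos : ∀ m, 0 < L m
  smooth : ∀ (m : Fin M) (x : State d) (y z : Block d m),
    ‖gradient (fun w : Block d m => U₀ (Function.update x m w)) y
      - gradient (fun w : Block d m => U₀ (Function.update x m w)) z‖ ≤ L m * ‖y - z‖
  lam_pos : 0 < lam
  strong_convex :
    ConvexOn ℝ Set.univ fun x : State d => U₀ x - lam / 2 * ∑ m, L m * ‖x m‖ ^ 2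

theorem measurable_rest {M : ℕ} {d : Fin M → ℕ} (m : Fin M) :
    Measurable (rest m : State d → Rest d m) :=
  measurable_pi_lambda _ fun i => measurable_pi_apply i.1

/-- The kernel `P̄_m` on `𝒳`: `P̄_m(x, A) = ∫ 1_A(y_m, x_{-m}) Q^{x_{-m}}(x_m, dy_m)`, where
`Q (x_{-m}, x_m) = Q^{x_{-m}}(x_m, ·)`. -/
noncomputable def coordKernel {M : ℕ} {d : Fin M → ℕ} (m : Fin M)
    (Q : Kernel (Rest d m × Block d m) (Block d m)) [IsMarkovKernel Q] :
    Kernel (State d) (State d) where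
  toFun x := (Q (rest m x, x m)).map (Function.update x m)
  measurable' := by
    refine Measure.measurable_of_measurable_coe _ fun A hA => ?_
    have hf : Measurable fun x : State d => (rest m x, x m) :=
      (measurable_rest m).prodMk (measurable_pi_apply m)
    have h := Kernel.measurable_kernel_prodMk_left (κ := Q.comap _ hf)
      ((measurable_update' (a := m) : Measurable
        fun p : State d × Block d m => Function.update p.1 m p.2) hA)
    have e : (fun x : State d => ((Q (rest m x, x m)).map (Function.update x m)) A) =
        fun x => Q.comap _ hf x (Prod.mk x ⁻¹'
          ((fun p : State d × Block d m => Function.update p.1 m p.2) ⁻¹' A)) := by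
      funext x
      rw [Measure.map_apply (measurable_update x) hA, Kernel.comap_apply]
      rfl
    rw [e]
    exact h

/-- The Metropolis-within-Gibbs kernel `(1/M) ∑ m, P̄_m` with conditional updates `Q m`. -/
noncomputable def mwgKernel {M : ℕ} {d : Fin M → ℕ}
    (Q : ∀ m : Fin M, Kernel (Rest d m × Block d m) (Block d m)) [∀ m, IsMarkovKernel (Q m)] :
    Kernel (State d) (State d) where
  toFun x := (M : ℝ≥0∞)⁻¹ • ∑ m : Fin M, coordKernel m (Q m) x
  measurable' := by
    refine Measure.measurable_of_measurable_coe _ fun A hA => ?_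
    simp only [Measure.smul_apply, Measure.finsetSum_apply, smul_eq_mul]
    exact (Finset.measurable_sum _ fun m _ =>
      Kernel.measurable_coe (coordKernel m (Q m)) hA).const_mul _

end MwG

namespace MwG

/-! Updating block `m` preserves the law of `x_{-m}` and contracts only the conditional law. By the
chain rule for the divergence, this gives `KL(μ P̄_m | π) ≤ (1 - β) KL(μ | π) + β KL(μ_{-m} |
π_{-m})` (`klDiv_bind_coordKernel_le`). Convexity of the divergence (`klDiv_average_le`) averages
this over `m`. For `β ≥ 0` it remains to show `∑ m, KL(μ_{-m} | π_{-m}) ≤ (M - λ) KL(μ | π)`, which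
is `sum_klDiv_rest_le`.

That entropy inequality is proved by duality. If `ρ_m` is the density of `μ_{-m}` with respect to
`π_{-m}`, the Gibbs variational inequality with test function `(∏ m, ρ_m)^(1/(M - t))` reduces it to
`∫ (∏ m, ρ_m)^(1/(M - t)) dπ ≤ 1`. This bound follows from a Prékopa–Leindler inequality in which
the `m`-th factor is evaluated at `x` with only block `m` moved to `(1 - t) x_m + t y_m`
(`lintegral_rpow_le_prod_moveTo`). Its pointwise hypothesis is `∑ m, U(x with block m moved) ≤ (M -
t) U(x) + t U(y)`. For `t ≤ λ` this holds because block smoothness costs `t²/2 ‖y - x‖_L²` while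
strong convexity returns `tλ/2 ‖y - x‖_L²` (`sum_moveTo_le`).

For `β < 0` the marginal term has the wrong sign. Reversibility and data processing then give the
case `β = 0`, which is stronger than the claim. -/

/-! ### One-dimensional Brunn–Minkowski and Prékopa–Leindler inequalities -/

theorem volume_add_le_of_isCompact {A B C : Set ℝ} (hA : IsCompact A) (hB : IsCompact B)
    (hA0 : A.Nonempty) (hB0 : B.Nonempty) (h : ∀ a ∈ A, ∀ b ∈ B, a + b ∈ C) :
    volume A + volume B ≤ volume C := by
  obtain ⟨p, hpA, hp⟩ := hA.exists_isGreatest hA0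
  obtain ⟨q, hqB, hq⟩ := hB.exists_isLeast hB0
  have h1 : volume ((fun x => x + q) '' A) = volume A := by
    simp
  have h2 : volume ((fun x => p + x) '' B) = volume B := by
    simp
  -- With `p = max A` and `q = min B`, one translate lies to the left of `p + q` and the other to
  -- its right.
  have hdis : AEDisjoint volume ((fun x => x + q) '' A) ((fun x => p + x) '' B) := by
    refine measure_mono_null (t := {p + q}) ?_ (by simp)
    rintro x ⟨⟨a, ha, rfl⟩, ⟨b, hb, hab⟩⟩
    have := hp ha
    have := hq hb
    simp only [Set.mem_singleton_iff] at *
    linarith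
  have hm : NullMeasurableSet ((fun x => p + x) '' B) volume :=
    (hB.image (by fun_prop)).isClosed.measurableSet.nullMeasurableSet
  rw [← h1, ← h2, ← measure_union₀ hm hdis]
  refine measure_mono ?_
  rintro x (⟨a, ha, rfl⟩ | ⟨b, hb, rfl⟩)
  · exact h a ha q hqB
  · exact h p hpA b hb

/-- One-dimensional Brunn–Minkowski inequality. -/
theorem volume_add_le {A B C : Set ℝ} (hA : MeasurableSet A) (hB : MeasurableSet B)
    (hA0 : A.Nonempty) (hB0 : B.Nonempty) (h : ∀ a ∈ A, ∀ b ∈ B, a + b ∈ C) :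
    volume A + volume B ≤ volume C := by
  obtain ⟨a₀, ha₀⟩ := hA0
  obtain ⟨b₀, hb₀⟩ := hB0
  have key : ∀ K ⊆ A, IsCompact K → ∀ L ⊆ B, IsCompact L → volume K + volume L ≤ volume C := by
    intro K hKA hK L hLB hL
    -- Adding the base points allows `K` and `L` to be empty; the empty case is used below to get
    -- `volume L ≤ volume C` and `volume A ≤ volume C`.
    refine (add_le_add (measure_mono (Set.subset_insert a₀ K))
      (measure_mono (Set.subset_insert b₀ L))).trans ?_
    refine volume_add_le_of_isCompact (hK.insert a₀) (hL.insert b₀) ⟨a₀, by simp⟩ ⟨b₀, by simp⟩ ?_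
    exact fun a ha b hb => h a (Set.insert_subset ha₀ hKA ha) b (Set.insert_subset hb₀ hLB hb)
  have key2 : ∀ L ⊆ B, IsCompact L → volume A + volume L ≤ volume C := by
    intro L hLB hL
    have hLC : volume L ≤ volume C := by
      simpa using key ∅ (by simp) isCompact_empty L hLB hL
    refine (ENNReal.le_sub_iff_add_le_right hL.measure_lt_top.ne hLC).1 ?_
    rw [hA.measure_eq_iSup_isCompact]
    refine iSup₂_le fun K hKA => iSup_le fun hK => ?_
    exact (ENNReal.le_sub_iff_add_le_right hL.measure_lt_top.ne hLC).2 (key K hKA hK L hLB hL)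
  have hAC : volume A ≤ volume C := by simpa using key2 ∅ (by simp) isCompact_empty
  rcases eq_or_ne (volume A) ∞ with hAt | hAt
  · rw [hAt] at hAC ⊢
    simpa using hAC
  · refine (ENNReal.le_sub_iff_add_le_left hAt hAC).1 ?_
    rw [hB.measure_eq_iSup_isCompact]
    refine iSup₂_le fun L hLB => iSup_le fun hL => ?_
    exact (ENNReal.le_sub_iff_add_le_left hAt hAC).2 (key2 L hLB hL)

theorem volume_convexComb_le {A B C : Set ℝ} (hA : MeasurableSet A) (hB : MeasurableSet B)
    (hA0 : A.Nonempty) (hB0 : B.Nonempty) {t : ℝ} (h0 : 0 < t) (h1 : t < 1)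
    (h : ∀ a ∈ A, ∀ b ∈ B, (1 - t) * a + t * b ∈ C) :
    ENNReal.ofReal (1 - t) * volume A + ENNReal.ofReal t * volume B ≤ volume C := by
  have e : ∀ (r : ℝ) (hr : 0 < r) (S : Set ℝ),
      volume ((fun x => r * x) '' S) = ENNReal.ofReal r * volume S := by
    intro r hr S
    have := Measure.addHaar_smul (volume : Measure ℝ) r S
    rw [← Set.image_smul] at this
    simpa [abs_of_pos hr] using this
  have em : ∀ (r : ℝ) (hr : 0 < r) (S : Set ℝ), MeasurableSet S →
      MeasurableSet ((fun x => r * x) '' S) := fun r hr S hS =>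
    (Homeomorph.mulLeft₀ r hr.ne').measurableEmbedding.measurableSet_image.2 hS
  rw [← e _ (by linarith), ← e _ h0]
  refine volume_add_le (em _ (by linarith) _ hA) (em _ h0 _ hB) (hA0.image _) (hB0.image _) ?_
  rintro _ ⟨a, ha, rfl⟩ _ ⟨b, hb, rfl⟩
  exact h a ha b hb

/-- Layer-cake formula plus Brunn–Minkowski on superlevel sets. Because both suprema are 1, the
superlevel sets of `f` and `g` are nonempty for the same levels `s < 1` and both empty for `s ≥ 1`.
-/
theorem lintegral_convexComb_le_of_sup_eq_one {f g h : ℝ → ℝ} (hf : Measurable f)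
    (hg : Measurable g) (hh : Measurable h) (hf0 : ∀ x, 0 ≤ f x) (hg0 : ∀ x, 0 ≤ g x)
    (hh0 : ∀ x, 0 ≤ h x) (hf1 : ∀ x, f x ≤ 1) (hg1 : ∀ x, g x ≤ 1)
    (hfs : ∀ s < 1, ∃ x, s < f x) (hgs : ∀ s < 1, ∃ x, s < g x)
    {t : ℝ} (h0 : 0 < t) (h1 : t < 1)
    (H : ∀ x y, f x ^ (1 - t) * g y ^ t ≤ h ((1 - t) * x + t * y)) :
    ENNReal.ofReal (1 - t) * (∫⁻ x, ENNReal.ofReal (f x)) +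
      ENNReal.ofReal t * (∫⁻ x, ENNReal.ofReal (g x)) ≤ ∫⁻ x, ENNReal.ofReal (h x) := by
  have lc : ∀ {k : ℝ → ℝ}, Measurable k → (∀ x, 0 ≤ k x) →
      ∫⁻ x, ENNReal.ofReal (k x) = ∫⁻ s in Set.Ioi 0, volume {x | s < k x} := fun hk hk0 =>
    lintegral_eq_lintegral_meas_lt volume (Filter.Eventually.of_forall hk0) hk.aemeasurable
  have ms : ∀ (k : ℝ → ℝ), Measurable fun s : ℝ => volume {x | s < k x} := fun k =>
    Antitone.measurable fun a b hab => measure_mono fun x hx => lt_of_le_of_lt hab hx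
  rw [lc hf hf0, lc hg hg0, lc hh hh0, ← lintegral_const_mul _ (ms f),
    ← lintegral_const_mul _ (ms g), ← lintegral_add_left ((ms f).const_mul _)]
  refine setLIntegral_mono (ms h) fun s hs => ?_
  rcases lt_or_ge s 1 with hs1 | hs1
  · refine volume_convexComb_le (measurableSet_lt measurable_const hf)
      (measurableSet_lt measurable_const hg) (hfs s hs1) (hgs s hs1) h0 h1 fun a ha b hb => ?_
    refine lt_of_lt_of_le ?_ (H a b)
    have hs0 : 0 < s := hs
    calc s = s ^ (1 - t) * s ^ t := by rw [← Real.rpow_add hs0]; simp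
      _ < f a ^ (1 - t) * g b ^ t :=
        mul_lt_mul'' (Real.rpow_lt_rpow hs0.le ha (by linarith)) (Real.rpow_lt_rpow hs0.le hb h0)
          (by positivity) (by positivity)
  · have ef : {x | s < f x} = ∅ := Set.eq_empty_of_forall_notMem fun x hx =>
      absurd hx (not_lt.2 ((hf1 x).trans hs1))
    have eg : {x | s < g x} = ∅ := Set.eq_empty_of_forall_notMem fun x hx =>
      absurd hx (not_lt.2 ((hg1 x).trans hs1))
    simp [ef, eg]

theorem rpow_mul_rpow_le_add (a b : ℝ≥0∞) {t : ℝ} (h0 : 0 < t) (h1 : t < 1) :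
    a ^ (1 - t) * b ^ t ≤ ENNReal.ofReal (1 - t) * a + ENNReal.ofReal t * b := by
  have h1' : 0 < 1 - t := by linarith
  have hpq : ((1 - t)⁻¹).HolderConjugate t⁻¹ := by
    rw [Real.holderConjugate_iff]
    refine ⟨(one_lt_inv₀ h1').2 (by linarith), by simp⟩
  have := ENNReal.young_inequality (a ^ (1 - t)) (b ^ t) hpq
  rw [← ENNReal.rpow_mul, ← ENNReal.rpow_mul, mul_inv_cancel₀ h1'.ne', mul_inv_cancel₀ h0.ne',
    ENNReal.rpow_one, ENNReal.rpow_one, ENNReal.ofReal_inv_of_pos h1', ENNReal.ofReal_inv_of_pos h0,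
    div_eq_mul_inv, div_eq_mul_inv, inv_inv, inv_inv] at this
  simpa [mul_comm] using this

/-- Dividing `f` and `g` by their suprema `a`, `b`, and `h` by `a ^ (1 - t) * b ^ t`, reduces to the
normalised case. Its arithmetic mean on the left dominates the geometric mean, which is homogeneous,
so the normalisation can be undone. -/
theorem prekopa_leindler_of_bounded {f g h : ℝ → ℝ≥0∞} (hf : Measurable f) (hg : Measurable g)
    (hh : Measurable h) (hfb : ⨆ x, f x ≠ ∞) (hgb : ⨆ x, g x ≠ ∞)
    {t : ℝ} (h0 : 0 < t) (h1 : t < 1)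
    (H : ∀ x y, f x ^ (1 - t) * g y ^ t ≤ h ((1 - t) * x + t * y)) :
    (∫⁻ x, f x) ^ (1 - t) * (∫⁻ x, g x) ^ t ≤ ∫⁻ x, h x := by
  have h1' : 0 < 1 - t := by linarith
  set a := ⨆ x, f x with ha
  set b := ⨆ x, g x with hb
  rcases eq_or_ne a 0 with ha0 | ha0
  · have : f = 0 := by
      funext x
      exact le_antisymm ((le_iSup f x).trans ha0.le) bot_le
    simp [this, ENNReal.zero_rpow_of_pos h1']
  rcases eq_or_ne b 0 with hb0 | hb0
  · have : g = 0 := by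
      funext x
      exact le_antisymm ((le_iSup g x).trans hb0.le) bot_le
    simp [this, ENNReal.zero_rpow_of_pos h0]
  set c := a ^ (1 - t) * b ^ t with hc
  have hc0 : c ≠ 0 := by
    refine mul_ne_zero ?_ ?_
    · simp [ENNReal.rpow_eq_zero_iff, ha0, hfb]
    · simp [ENNReal.rpow_eq_zero_iff, hb0, hgb]
  have hct : c ≠ ∞ := ENNReal.mul_ne_top (ENNReal.rpow_ne_top_of_nonneg h1'.le hfb)
    (ENNReal.rpow_ne_top_of_nonneg h0.le hgb)
  have fa : ∀ x, f x / a ≤ 1 := fun x => ENNReal.div_le_of_le_mul (by simpa using le_iSup f x)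
  have gb : ∀ x, g x / b ≤ 1 := fun x => ENNReal.div_le_of_le_mul (by simpa using le_iSup g x)
  have sup_lt : ∀ (k : ℝ → ℝ≥0∞) (d : ℝ≥0∞), d = ⨆ x, k x → d ≠ 0 → d ≠ ∞ →
      (∀ x, k x / d ≤ 1) → ∀ s < (1 : ℝ), ∃ x, s < (k x / d).toReal := by
    intro k d hd hd0 hdt hk s hs
    have hlt : ENNReal.ofReal s * d < d := by
      calc ENNReal.ofReal s * d < 1 * d :=
            ENNReal.mul_lt_mul_left hd0 hdt (by simpa using hs)
        _ = d := one_mul d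
    conv_rhs at hlt => rw [hd]
    obtain ⟨x, hx⟩ := lt_iSup_iff.1 hlt
    refine ⟨x, ?_⟩
    have : ENNReal.ofReal s < k x / d := by
      rw [ENNReal.lt_div_iff_mul_lt (Or.inl hd0) (Or.inl hdt)]
      exact hx
    by_contra! hle
    refine absurd this (not_lt.2 ?_)
    rw [← ENNReal.ofReal_toReal (ne_top_of_le_ne_top ENNReal.one_ne_top (hk x))]
    exact ENNReal.ofReal_le_ofReal hle
  have key := lintegral_convexComb_le_of_sup_eq_one (f := fun x => (f x / a).toReal)
    -- The truncation at 1 keeps `toReal` faithful when `h` is infinite; it is harmless because the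
    -- normalised left-hand side is at most 1.
    (g := fun x => (g x / b).toReal) (h := fun x => (min 1 (h x / c)).toReal)
    (hf.div_const a).ennreal_toReal (hg.div_const b).ennreal_toReal
    (measurable_const.min (hh.div_const c)).ennreal_toReal
    (fun _ => ENNReal.toReal_nonneg) (fun _ => ENNReal.toReal_nonneg)
    (fun _ => ENNReal.toReal_nonneg)
    (fun x => ENNReal.toReal_le_of_le_ofReal zero_le_one (by simpa using fa x))
    (fun x => ENNReal.toReal_le_of_le_ofReal zero_le_one (by simpa using gb x))
    (sup_lt f a ha ha0 hfb fa) (sup_lt g b hb hb0 hgb gb) h0 h1 ?_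
  · have e1 : ∀ x, ENNReal.ofReal (f x / a).toReal = f x / a := fun x =>
      ENNReal.ofReal_toReal (ne_top_of_le_ne_top ENNReal.one_ne_top (fa x))
    have e2 : ∀ x, ENNReal.ofReal (g x / b).toReal = g x / b := fun x =>
      ENNReal.ofReal_toReal (ne_top_of_le_ne_top ENNReal.one_ne_top (gb x))
    have e3 : ∀ x, ENNReal.ofReal (min 1 (h x / c)).toReal ≤ h x / c := fun x =>
      ENNReal.ofReal_toReal_le.trans (min_le_right _ _)
    simp only [e1, e2] at key
    have key2 := (rpow_mul_rpow_le_add _ _ h0 h1).trans (key.trans (lintegral_mono e3))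
    simp only [div_eq_mul_inv] at key2
    rw [lintegral_mul_const _ hf, lintegral_mul_const _ hg, lintegral_mul_const _ hh,
      ENNReal.mul_rpow_of_nonneg _ _ h1'.le, ENNReal.mul_rpow_of_nonneg _ _ h0.le,
      mul_mul_mul_comm, ENNReal.inv_rpow, ENNReal.inv_rpow,
      ← ENNReal.mul_inv (Or.inl (by simp [ENNReal.rpow_eq_zero_iff, ha0, hfb]))
        (Or.inl (ENNReal.rpow_ne_top_of_nonneg h1'.le hfb)), ← hc] at key2
    exact (ENNReal.mul_le_mul_iff_left (ENNReal.inv_ne_zero.2 hct)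
      (ENNReal.inv_ne_top.2 hc0)).1 key2
  · intro x y
    rw [ENNReal.toReal_rpow, ENNReal.toReal_rpow, ← ENNReal.toReal_mul]
    refine ENNReal.toReal_mono (by simp) (le_min ?_ ?_)
    · exact mul_le_one' (ENNReal.rpow_le_one (fa x) h1'.le) (ENNReal.rpow_le_one (gb y) h0.le)
    · rw [ENNReal.div_rpow_of_nonneg _ _ h1'.le, ENNReal.div_rpow_of_nonneg _ _ h0.le,
        div_eq_mul_inv, div_eq_mul_inv, mul_mul_mul_comm,
        ← ENNReal.mul_inv (Or.inl (by simp [ENNReal.rpow_eq_zero_iff, ha0, hfb]))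
        (Or.inl (ENNReal.rpow_ne_top_of_nonneg h1'.le hfb)), ← hc, div_eq_mul_inv]
      gcongr
      exact H x y

theorem lintegral_rpow_le_of_forall_min {f : ℝ → ℝ≥0∞} (hf : Measurable f) {r : ℝ} (hr : 0 < r)
    {c d : ℝ≥0∞} (h : ∀ n : ℕ, (∫⁻ x, min (f x) n) ^ r * c ≤ d) :
    (∫⁻ x, f x) ^ r * c ≤ d := by
  have e : ∫⁻ x, f x = ⨆ n : ℕ, ∫⁻ x, min (f x) n := by
    rw [← lintegral_iSup (fun n => hf.min measurable_const)
      (fun m n hmn x => min_le_min_left _ (by exact_mod_cast hmn))]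
    congr 1 with x
    rw [← inf_iSup_eq, ENNReal.iSup_natCast, inf_top_eq]
  have e2 : (∫⁻ x, f x) ^ r = ⨆ n : ℕ, (∫⁻ x, min (f x) n) ^ r := by
    rw [e]
    exact (ENNReal.orderIsoRpow r hr).map_iSup _
  rw [e2, ENNReal.iSup_mul]
  exact iSup_le h

/-- One-dimensional Prékopa–Leindler inequality. -/
theorem prekopa_leindler {f g h : ℝ → ℝ≥0∞} (hf : Measurable f) (hg : Measurable g)
    (hh : Measurable h) {t : ℝ} (h0 : 0 < t) (h1 : t < 1)
    (H : ∀ x y, f x ^ (1 - t) * g y ^ t ≤ h ((1 - t) * x + t * y)) :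
    (∫⁻ x, f x) ^ (1 - t) * (∫⁻ x, g x) ^ t ≤ ∫⁻ x, h x := by
  have h1' : 0 < 1 - t := by linarith
  refine lintegral_rpow_le_of_forall_min hf h1' fun m => ?_
  rw [mul_comm]
  refine lintegral_rpow_le_of_forall_min hg h0 fun n => ?_
  rw [mul_comm]
  refine prekopa_leindler_of_bounded (hf.min measurable_const) (hg.min measurable_const) hh
    (ne_top_of_le_ne_top (ENNReal.natCast_ne_top m) (iSup_le fun _ => min_le_right _ _))
    (ne_top_of_le_ne_top (ENNReal.natCast_ne_top n) (iSup_le fun _ => min_le_right _ _)) h0 h1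
    fun x y => le_trans ?_ (H x y)
  gcongr <;> exact min_le_left _ _


/-! ### The Prékopa–Leindler–Hölder inequality and its tensorisation -/

/-- The point obtained from `x` by moving the coordinates of label `m` towards `y`. -/
def moveBlock {ι κ : Type*} [DecidableEq κ] (b : ι → κ) (t : ℝ) (m : κ) (x y : ι → ℝ) : ι → ℝ :=
  fun i => if b i = m then (1 - t) * x i + t * y i else x i

theorem moveBlock_update {ι κ : Type*} [DecidableEq κ] [DecidableEq ι] (b : ι → κ)
    (t : ℝ) (m : κ) (x y : ι → ℝ) (i : ι) (u v : ℝ) :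
    moveBlock b t m (Function.update x i u) (Function.update y i v) =
      Function.update (moveBlock b t m x y) i (if b i = m then (1 - t) * u + t * v else u) := by
  funext j
  rcases eq_or_ne j i with rfl | hj
  · simp [moveBlock]
  · simp [moveBlock, hj]

section Step

variable {κ : Type*} [Fintype κ] [DecidableEq κ]

/-- A one-dimensional inequality interpolating between the Prékopa–Leindler inequality and the
Hölder inequality: only the `k`-th function is evaluated at the intermediate point. -/
theorem prekopa_leindler_holder (k : κ) {f g h : ℝ → ℝ≥0∞} {F : κ → ℝ → ℝ≥0∞}
    (hf : Measurable f) (hg : Measurable g) (hF : ∀ m, Measurable (F m))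
    (hh : Measurable h)
    {t : ℝ} (h0 : 0 < t) (h1 : t < 1)
    (H : ∀ x y, f x ^ (Fintype.card κ - t) * g y ^ t ≤
      (∏ m ∈ Finset.univ.erase k, F m x) * h ((1 - t) * x + t * y)) :
    (∫⁻ x, f x) ^ (Fintype.card κ - t) * (∫⁻ x, g x) ^ t ≤
      (∏ m ∈ Finset.univ.erase k, ∫⁻ x, F m x) * ∫⁻ x, h x := by
  have h1' : 0 < 1 - t := by linarith
  have hcard : 1 ≤ Fintype.card κ := Fintype.card_pos_iff.2 ⟨k⟩
  have hN1 : (1 : ℝ) ≤ Fintype.card κ := by exact_mod_cast hcard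
  set N : ℝ := (Fintype.card κ : ℝ) with hN
  have hr : 0 < N - t := by linarith
  set A : ℝ → ℝ≥0∞ := fun x => ∏ m ∈ Finset.univ.erase k, F m x with hA
  have hAm : Measurable A := Finset.measurable_fun_prod _ fun m _ => hF m
  by_cases hg0 : ∀ y, g y = 0
  · simp [hg0, ENNReal.zero_rpow_of_pos h0]
  push Not at hg0
  obtain ⟨y₀, hy₀⟩ := hg0
  have fzero : ∀ x, A x = 0 → f x = 0 := by
    intro x hx
    have := H x y₀
    rw [show (∏ m ∈ Finset.univ.erase k, F m x) = 0 from hx, zero_mul] at this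
    rcases mul_eq_zero.1 (le_antisymm this bot_le) with h | h
    · exact (ENNReal.rpow_eq_zero_iff_of_pos hr).1 h
    · exact absurd ((ENNReal.rpow_eq_zero_iff_of_pos h0).1 h) hy₀
  -- vanishing factors on the right-hand side
  by_cases hz : ∃ m ∈ Finset.univ.erase k, ∫⁻ x, F m x = 0
  · obtain ⟨m, hm, hmz⟩ := hz
    have hf0 : f =ᵐ[volume] 0 := by
      filter_upwards [(lintegral_eq_zero_iff (hF m)).1 hmz] with x hx
      exact fzero x (Finset.prod_eq_zero hm hx)
    simp [lintegral_congr_ae hf0, ENNReal.zero_rpow_of_pos hr]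
  push Not at hz
  have hprod0 : ∏ m ∈ Finset.univ.erase k, ∫⁻ x, F m x ≠ 0 := Finset.prod_ne_zero_iff.2 hz
  -- Treated before the infinite factors, since `∞ * 0 = 0`. Prékopa–Leindler for the indicators of
  -- the supports forces `f` or `g` to vanish almost everywhere.
  by_cases hhz : ∫⁻ x, h x = 0
  · have hpos : ∀ {u : ℝ → ℝ≥0∞}, Measurable u → MeasurableSet {x | u x ≠ 0} := fun hu =>
      (hu (measurableSet_singleton 0)).compl
    have key := prekopa_leindler (f := Set.indicator {x | f x ≠ 0} 1)
      (g := Set.indicator {x | g x ≠ 0} 1) (h := Set.indicator {x | h x ≠ 0} 1)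
      (measurable_one.indicator (hpos hf)) (measurable_one.indicator (hpos hg))
      (measurable_one.indicator (hpos hh)) h0 h1 ?_
    · rw [lintegral_indicator_one (hpos hf), lintegral_indicator_one (hpos hg),
        lintegral_indicator_one (hpos hh)] at key
      have hv : volume {x | h x ≠ 0} = 0 := (lintegral_eq_zero_iff hh).1 hhz
      rw [hv] at key
      rcases mul_eq_zero.1 (le_antisymm key bot_le) with h | h
      · have : f =ᵐ[volume] 0 := (ENNReal.rpow_eq_zero_iff_of_pos h1').1 h
        simp [lintegral_congr_ae this, ENNReal.zero_rpow_of_pos hr]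
      · have : g =ᵐ[volume] 0 := (ENNReal.rpow_eq_zero_iff_of_pos h0).1 h
        simp [lintegral_congr_ae this, ENNReal.zero_rpow_of_pos h0]
    · intro x y
      by_cases hx : f x = 0
      · simp [hx, ENNReal.zero_rpow_of_pos h1']
      by_cases hy : g y = 0
      · simp [hy, ENNReal.zero_rpow_of_pos h0]
      have : h ((1 - t) * x + t * y) ≠ 0 := by
        intro hc
        have := H x y
        rw [hc, mul_zero] at this
        rcases mul_eq_zero.1 (le_antisymm this bot_le) with h | h
        · exact hx ((ENNReal.rpow_eq_zero_iff_of_pos hr).1 h)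
        · exact hy ((ENNReal.rpow_eq_zero_iff_of_pos h0).1 h)
      simp [hx, hy, this]
  -- infinite factors on the right-hand side
  by_cases htop : ∃ m ∈ Finset.univ.erase k, ∫⁻ x, F m x = ∞
  · obtain ⟨m, hm, hmt⟩ := htop
    have : ∏ m ∈ Finset.univ.erase k, ∫⁻ x, F m x = ∞ := by
      rw [← Finset.mul_prod_erase _ _ hm, hmt]
      exact ENNReal.top_mul (Finset.prod_ne_zero_iff.2 fun i hi =>
        hz i (Finset.mem_of_mem_erase hi))
    rw [this, ENNReal.top_mul hhz]
    exact le_top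
  push Not at htop
  have hAt : ∀ᵐ x, A x ≠ ∞ := by
    have : ∀ m ∈ Finset.univ.erase k, ∀ᵐ x, F m x ≠ ∞ := fun m hm =>
      (ae_lt_top (hF m) (htop m hm)).mono fun x hx => hx.ne
    filter_upwards [(Finset.eventually_all _).2 this] with x hx
    exact ENNReal.prod_ne_top hx
  -- `K` is chosen so that the hypothesis becomes `K x ^ (1 - t) * g y ^ t ≤ h (…)`, to which
  -- Prékopa–Leindler applies. Solving for `f` gives, almost everywhere, a weighted geometric mean
  -- of `K` and the `F m`, to which Hölder applies.
  set K : ℝ → ℝ≥0∞ := fun x => (f x ^ (N - t) / A x) ^ (1 - t)⁻¹ with hK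
  have hKm : Measurable K := ((hf.pow_const _).div hAm).pow_const _
  have hK1 : ∀ x, K x ^ (1 - t) = f x ^ (N - t) / A x := fun x => by
    rw [hK, ENNReal.rpow_inv_rpow h1'.ne']
  have pl := prekopa_leindler hKm hg hh h0 h1 fun x y => by
    rw [hK1, div_eq_mul_inv, mul_right_comm, ← div_eq_mul_inv]
    exact ENNReal.div_le_of_le_mul' (H x y)
  -- The weights sum to 1: `(1 - t) + (N - 1) = N - t`.
  let p : κ → ℝ := fun m => if m = k then (1 - t) / (N - t) else 1 / (N - t)
  let Φ : κ → ℝ → ℝ≥0∞ := fun m => if m = k then K else F m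
  have hp0 : ∀ m, 0 ≤ p m := fun m => by
    simp only [p]
    split_ifs <;> positivity
  have hp1 : ∑ m, p m = 1 := by
    rw [← Finset.add_sum_erase _ _ (Finset.mem_univ k)]
    have : ∑ m ∈ Finset.univ.erase k, p m = (N - 1) * (1 / (N - t)) := by
      rw [Finset.sum_congr rfl (g := fun _ => 1 / (N - t))
        fun m hm => by simp [p, Finset.ne_of_mem_erase hm]]
      rw [Finset.sum_const, Finset.card_erase_of_mem (Finset.mem_univ k), Finset.card_univ,
        nsmul_eq_mul, Nat.cast_sub hcard, Nat.cast_one]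
    rw [this]
    simp only [p, if_true]
    field_simp
    ring
  have hΦm : ∀ m, Measurable (Φ m) := fun m => by
    simp only [Φ]
    split_ifs
    exacts [hKm, hF m]
  have hol := ENNReal.lintegral_prod_norm_pow_le (μ := (volume : Measure ℝ)) Finset.univ
    (f := Φ) (fun m _ => (hΦm m).aemeasurable) hp1 fun m _ => hp0 m
  have hsplit : ∀ (a : ℝ≥0∞) (G : κ → ℝ≥0∞),
      (∏ m, (if m = k then a else G m) ^ p m) ^ (N - t) =
        a ^ (1 - t) * ∏ m ∈ Finset.univ.erase k, G m := by
    intro a G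
    rw [← ENNReal.prod_rpow_of_nonneg hr.le, ← Finset.mul_prod_erase _ _ (Finset.mem_univ k)]
    congr 1
    · simp only [if_true, p]
      rw [← ENNReal.rpow_mul, div_mul_cancel₀ _ hr.ne']
    · refine Finset.prod_congr rfl fun m hm => ?_
      simp only [p, Finset.ne_of_mem_erase hm, if_false]
      rw [← ENNReal.rpow_mul, div_mul_cancel₀ _ hr.ne', ENNReal.rpow_one]
  have hfΦ : ∀ᵐ x, f x = ∏ m, Φ m x ^ p m := by
    filter_upwards [hAt] with x hx
    have e := hsplit (K x) (fun m => F m x)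
    have e' : (∏ m, Φ m x ^ p m) ^ (N - t) = f x ^ (N - t) := by
      have : ∀ m, Φ m x = if m = k then K x else F m x := fun m => by
        simp only [Φ]
        split_ifs <;> rfl
      simp only [this]
      rw [e, hK1]
      by_cases hx0 : A x = 0
      · simp [fzero x hx0, ENNReal.zero_rpow_of_pos hr]
      · exact ENNReal.div_mul_cancel hx0 hx
    exact (ENNReal.rpow_left_injective hr.ne' e').symm
  have hfin : (∫⁻ x, f x) ^ (N - t) ≤
      (∫⁻ x, K x) ^ (1 - t) * ∏ m ∈ Finset.univ.erase k, ∫⁻ x, F m x := by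
    rw [← hsplit, lintegral_congr_ae hfΦ]
    refine ENNReal.rpow_le_rpow (hol.trans_eq (Finset.prod_congr rfl fun m _ => ?_)) hr.le
    simp only [Φ]
    split_ifs <;> rfl
  calc (∫⁻ x, f x) ^ (N - t) * (∫⁻ x, g x) ^ t
      ≤ ((∫⁻ x, K x) ^ (1 - t) * ∏ m ∈ Finset.univ.erase k, ∫⁻ x, F m x) * (∫⁻ x, g x) ^ t := by
        gcongr
    _ = (∏ m ∈ Finset.univ.erase k, ∫⁻ x, F m x) *
        ((∫⁻ x, K x) ^ (1 - t) * (∫⁻ x, g x) ^ t) := by ring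
    _ ≤ _ := by gcongr


/-- Coordinates are integrated out one at a time. Changing coordinate `i` affects only the factor of
label `b i` through an intermediate point; every other factor sees the coordinate of `x` alone,
which is the form of `prekopa_leindler_holder`. -/
theorem lmarginal_rpow_le_prod {ι : Type*} [DecidableEq ι] (b : ι → κ)
    {f g : (ι → ℝ) → ℝ≥0∞} {F : κ → (ι → ℝ) → ℝ≥0∞}
    (hf : Measurable f) (hg : Measurable g) (hF : ∀ m, Measurable (F m))
    {t : ℝ} (h0 : 0 < t) (h1 : t < 1)
    (H : ∀ x y, f x ^ (Fintype.card κ - t) * g y ^ t ≤ ∏ m, F m (moveBlock b t m x y))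
    (s : Finset ι) (x y : ι → ℝ) :
    (lmarginal (fun _ => volume) s f x) ^ (Fintype.card κ - t) *
      (lmarginal (fun _ => volume) s g y) ^ t ≤
        ∏ m, lmarginal (fun _ => volume) s (F m) (moveBlock b t m x y) := by
  induction s using Finset.induction_on generalizing x y with
  | empty => simpa using H x y
  | insert i s his ih =>
    have hm : ∀ {φ : (ι → ℝ) → ℝ≥0∞}, Measurable φ → ∀ z : ι → ℝ,
        Measurable fun u : ℝ => lmarginal (fun _ => volume) s φ (Function.update z i u) :=
      fun hφ z => (hφ.lmarginal _).comp (measurable_update z)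
    have key := prekopa_leindler_holder (b i) (hm hf x) (hm hg y)
      (fun m => hm (hF m) (moveBlock b t m x y))
      (hm (hF (b i)) (moveBlock b t (b i) x y)) h0 h1 fun u v => by
        refine (ih (Function.update x i u) (Function.update y i v)).trans_eq ?_
        rw [← Finset.prod_erase_mul _ _ (Finset.mem_univ (b i))]
        congr 1
        · refine Finset.prod_congr rfl fun m hm => ?_
          rw [moveBlock_update, if_neg (Finset.ne_of_mem_erase hm).symm]
        · rw [moveBlock_update, if_pos rfl]
    rw [Finset.prod_erase_mul _ _ (Finset.mem_univ (b i))] at key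
    rw [lmarginal_insert _ hf his, lmarginal_insert _ hg his]
    simpa only [lmarginal_insert _ (hF _) his] using key

theorem lintegral_rpow_le_prod {ι : Type*} [Fintype ι] [DecidableEq ι] (b : ι → κ)
    {f g : (ι → ℝ) → ℝ≥0∞} {F : κ → (ι → ℝ) → ℝ≥0∞}
    (hf : Measurable f) (hg : Measurable g) (hF : ∀ m, Measurable (F m))
    {t : ℝ} (h0 : 0 < t) (h1 : t < 1)
    (H : ∀ x y, f x ^ (Fintype.card κ - t) * g y ^ t ≤ ∏ m, F m (moveBlock b t m x y)) :
    (∫⁻ x, f x) ^ (Fintype.card κ - t) * (∫⁻ x, g x) ^ t ≤ ∏ m, ∫⁻ x, F m x := by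
  have := lmarginal_rpow_le_prod b hf hg hF h0 h1 H Finset.univ 0 0
  simp only [lmarginal_univ] at this
  exact this

end Step


/-! ### Passing from real coordinates to Euclidean blocks -/

section Blocks

variable {M : ℕ} {d : Fin M → ℕ}

/-- The state with coordinates `z`. -/
def ofCoords (z : (Σ m, Fin (d m)) → ℝ) : State d :=
  fun m => WithLp.toLp 2 fun j => z ⟨m, j⟩

theorem measurePreserving_piCurry_symm (d : Fin M → ℕ) :
    MeasurePreserving (MeasurableEquiv.piCurry fun (m : Fin M) (_ : Fin (d m)) => ℝ).symm := by
  refine ⟨MeasurableEquiv.measurable _, ?_⟩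
  refine (Measure.pi_eq fun s hs => ?_).symm
  rw [Measure.map_apply (MeasurableEquiv.measurable _) (MeasurableSet.univ_pi hs),
    MeasurableEquiv.coe_piCurry_symm,
    show Sigma.uncurry ⁻¹' Set.univ.pi s = Set.univ.pi fun m => Set.univ.pi fun j => s ⟨m, j⟩ by
      simpa using Set.uncurry_preimage_sigma_pi (β := fun (m : Fin M) (_ : Fin (d m)) => ℝ)
        Set.univ (fun _ => Set.univ) s, volume_pi_pi]
  simp_rw [volume_pi_pi]
  rw [← Finset.univ_sigma_univ, Finset.prod_sigma]

theorem measurePreserving_ofCoords : MeasurePreserving (ofCoords (d := d)) :=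
  (volume_preserving_pi fun m => PiLp.volume_preserving_toLp (Fin (d m))).comp
    ((measurePreserving_piCurry_symm d).symm _)

/-- The `m`-th block of `x` is moved to `(1 - t) • x m + t • y m`. -/
noncomputable def moveTo (t : ℝ) (m : Fin M) (x y : State d) : State d :=
  Function.update x m ((1 - t) • x m + t • y m)

theorem ofCoords_moveBlock (t : ℝ) (m : Fin M) (x y : (Σ m, Fin (d m)) → ℝ) :
    ofCoords (moveBlock Sigma.fst t m x y) = moveTo t m (ofCoords x) (ofCoords y) := by
  funext i
  rcases eq_or_ne i m with rfl | h
  · simp only [moveTo, Function.update_self]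
    ext j
    simp [ofCoords, moveBlock]
  · simp only [moveTo, Function.update_of_ne h]
    ext j
    simp [ofCoords, moveBlock, h]

/-- A multi-block inequality of Prékopa–Leindler type. -/
theorem lintegral_rpow_le_prod_moveTo {f g : State d → ℝ≥0∞} {F : Fin M → State d → ℝ≥0∞}
    (hf : Measurable f) (hg : Measurable g) (hF : ∀ m, Measurable (F m))
    {t : ℝ} (h0 : 0 < t) (h1 : t < 1)
    (H : ∀ x y, f x ^ (M - t) * g y ^ t ≤ ∏ m, F m (moveTo t m x y)) :
    (∫⁻ x, f x) ^ (M - t) * (∫⁻ x, g x) ^ t ≤ ∏ m, ∫⁻ x, F m x := by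
  have hmp := measurePreserving_ofCoords (d := d)
  have := lintegral_rpow_le_prod (Sigma.fst : (Σ m, Fin (d m)) → Fin M) (hf.comp hmp.measurable)
    (hg.comp hmp.measurable) (fun m => (hF m).comp hmp.measurable) h0 h1 fun x y => by
      simpa only [Fintype.card_fin, Function.comp, ofCoords_moveBlock] using
        H (ofCoords x) (ofCoords y)
  simpa only [Fintype.card_fin, Function.comp, hmp.lintegral_comp hf, hmp.lintegral_comp hg,
    hmp.lintegral_comp (hF _)] using this

end Blocks

/-! ### Smoothness and convexity of the potential -/

/-- The quadratic upper bound for a function whose gradient is Lipschitz. -/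
theorem le_add_inner_add_of_lipschitz_gradient {E : Type*} [NormedAddCommGroup E]
    [InnerProductSpace ℝ E] [CompleteSpace E] {φ : E → ℝ} (hφ : Differentiable ℝ φ) {L : ℝ}
    (hL : ∀ y z, ‖gradient φ y - gradient φ z‖ ≤ L * ‖y - z‖) (x v : E) :
    φ (x + v) ≤ φ x + fderiv ℝ φ x v + L / 2 * ‖v‖ ^ 2 := by
  have hder : ∀ s : ℝ, HasDerivAt (fun s : ℝ => φ (x + s • v)) (fderiv ℝ φ (x + s • v) v) s := by
    intro s
    have h1 : HasDerivAt (fun s : ℝ => x + s • v) v s := by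
      simpa using ((hasDerivAt_id s).smul_const v).const_add x
    exact (hφ (x + s • v)).hasFDerivAt.comp_hasDerivAt s h1
  have hB : ∀ s : ℝ, HasDerivAt (fun s : ℝ => φ x + s * fderiv ℝ φ x v + L / 2 * ‖v‖ ^ 2 * s ^ 2)
      (fderiv ℝ φ x v + L * ‖v‖ ^ 2 * s) s := by
    intro s
    have h1 := (((hasDerivAt_id s).mul_const (fderiv ℝ φ x v)).const_add (φ x)).add
      (((hasDerivAt_id s).pow 2).const_mul (L / 2 * ‖v‖ ^ 2))
    convert! h1 using 1
    simp
    ring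
  have key := image_le_of_deriv_right_le_deriv_boundary (a := 0) (b := 1)
    (f := fun s : ℝ => φ (x + s • v))
    (B := fun s : ℝ => φ x + s * fderiv ℝ φ x v + L / 2 * ‖v‖ ^ 2 * s ^ 2)
    (fun s _ => (hder s).continuousAt.continuousWithinAt)
    (fun s _ => (hder s).hasDerivWithinAt) (by simp)
    (fun s _ => (hB s).continuousAt.continuousWithinAt)
    (fun s _ => (hB s).hasDerivWithinAt) ?_ (x := 1) (by simp)
  · simpa using key
  · intro s hs
    have e : ∀ y, fderiv ℝ φ y v = inner ℝ (gradient φ y) v := fun y => by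
      rw [gradient, InnerProductSpace.toDual_symm_apply]
    have h1 : fderiv ℝ φ (x + s • v) v - fderiv ℝ φ x v ≤ L * ‖v‖ ^ 2 * s := by
      rw [e, e, ← inner_sub_left]
      refine (real_inner_le_norm _ _).trans ?_
      calc ‖gradient φ (x + s • v) - gradient φ x‖ * ‖v‖ ≤ L * ‖x + s • v - x‖ * ‖v‖ := by
            gcongr
            exact hL _ _
        _ = L * ‖v‖ ^ 2 * s := by
            rw [add_sub_cancel_left, norm_smul, Real.norm_of_nonneg hs.1]
            ring
    linarith

namespace BlockConvexSmooth

variable {M : ℕ} {d : Fin M → ℕ} {U U₀ : State d → ℝ} {V : ∀ m, Block d m → ℝ} {L : Fin M → ℝ}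
  {lam : ℝ}

theorem differentiable (h : BlockConvexSmooth U U₀ V L lam) : Differentiable ℝ U₀ :=
  h.contDiff.differentiable one_ne_zero

theorem update_le (h : BlockConvexSmooth U U₀ V L lam) (m : Fin M) (x : State d)
    (v : Block d m) :
    U₀ (Function.update x m (x m + v)) ≤
      U₀ x + fderiv ℝ U₀ x (Pi.single m v) + L m / 2 * ‖v‖ ^ 2 := by
  have hc : ∀ w, HasFDerivAt (fun w : Block d m => U₀ (Function.update x m w))
      ((fderiv ℝ U₀ (Function.update x m w)).comp
        (ContinuousLinearMap.pi (Pi.single m (ContinuousLinearMap.id ℝ (Block d m))))) w := fun w =>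
    (h.differentiable _).hasFDerivAt.comp w (hasFDerivAt_update x w)
  have := le_add_inner_add_of_lipschitz_gradient (fun w => (hc w).differentiableAt)
    (h.smooth m x) (x m) v
  rw [(hc _).fderiv, Function.update_eq_self] at this
  refine this.trans_eq ?_
  have e : ContinuousLinearMap.pi (Pi.single m (ContinuousLinearMap.id ℝ (Block d m))) v =
      (Pi.single m v : State d) := by
    funext i
    rcases eq_or_ne i m with rfl | hi
    · simp
    · simp [hi]
  rw [ContinuousLinearMap.comp_apply, e]

/-- First-order form of strong convexity: the convexity inequality on the segment from `x` to `x +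
v`, divided by `s`, in the limit `s → 0+`. -/
theorem fderiv_add_le (h : BlockConvexSmooth U U₀ V L lam) (x v : State d) :
    fderiv ℝ U₀ x v + lam / 2 * ∑ m, L m * ‖v m‖ ^ 2 ≤ U₀ (x + v) - U₀ x := by
  set q := lam / 2 * ∑ m, L m * ‖v m‖ ^ 2 with hq
  have hconv : ∀ s ∈ Set.Ioo (0 : ℝ) 1,
      s⁻¹ * (U₀ (x + s • v) - U₀ x) ≤ U₀ (x + v) - U₀ x - (1 - s) * q := by
    intro s hs
    have hc := h.strong_convex.2 (Set.mem_univ x) (Set.mem_univ (x + v))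
      (sub_nonneg.2 hs.2.le) hs.1.le (by ring)
    have e1 : (1 - s) • x + s • (x + v) = x + s • v := by
      rw [smul_add, ← add_assoc, ← add_smul]
      simp
    have e2 : ∀ m, ‖(x + s • v) m‖ ^ 2 = (1 - s) * ‖x m‖ ^ 2 + s * ‖(x + v) m‖ ^ 2
        - s * (1 - s) * ‖v m‖ ^ 2 := by
      intro m
      simp only [Pi.add_apply, Pi.smul_apply, norm_add_sq_real, norm_smul, inner_smul_right,
        Real.norm_of_nonneg hs.1.le]
      ring
    have e3 : ∑ m, L m * ‖(x + s • v) m‖ ^ 2 = (1 - s) * ∑ m, L m * ‖x m‖ ^ 2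
        + s * ∑ m, L m * ‖(x + v) m‖ ^ 2 - s * (1 - s) * ∑ m, L m * ‖v m‖ ^ 2 := by
      rw [Finset.mul_sum, Finset.mul_sum, Finset.mul_sum, ← Finset.sum_add_distrib,
        ← Finset.sum_sub_distrib]
      refine Finset.sum_congr rfl fun m _ => ?_
      rw [e2]
      ring
    rw [e1] at hc
    simp only [e3, smul_eq_mul] at hc
    have : U₀ (x + s • v) - U₀ x ≤ s * (U₀ (x + v) - U₀ x - (1 - s) * q) := by
      rw [hq]
      linarith
    rwa [inv_mul_le_iff₀ hs.1]
  have hder : HasDerivAt (fun s : ℝ => U₀ (x + s • v)) (fderiv ℝ U₀ x v) 0 := by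
    have h1 : HasDerivAt (fun s : ℝ => x + s • v) v 0 := by
      simpa using ((hasDerivAt_id (0 : ℝ)).smul_const v).const_add x
    have h2 : HasFDerivAt U₀ (fderiv ℝ U₀ x) (x + (0 : ℝ) • v) := by
      simpa using (h.differentiable x).hasFDerivAt
    exact h2.comp_hasDerivAt 0 h1
  have ht := (hasDerivAt_iff_tendsto_slope_zero.1 hder).mono_left
    (nhdsWithin_mono _ (fun s hs => ne_of_gt hs) : nhdsWithin 0 (Set.Ioi (0 : ℝ)) ≤ _)
  have ht2 : Filter.Tendsto (fun s : ℝ => U₀ (x + v) - U₀ x - (1 - s) * q)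
      (nhdsWithin 0 (Set.Ioi 0)) (nhds (U₀ (x + v) - U₀ x - (1 - 0) * q)) :=
    (Continuous.tendsto (by fun_prop) 0).mono_left nhdsWithin_le_nhds
  have := le_of_tendsto_of_tendsto ht ht2 <| by
    filter_upwards [Ioo_mem_nhdsGT (zero_lt_one' ℝ)] with s hs
    simpa using hconv s hs
  linarith

/-- Along a nonzero direction in a single block, the quadratic lower bound cannot exceed the
quadratic upper bound. -/
theorem le_one (h : BlockConvexSmooth U U₀ V L lam) [Nontrivial (State d)] : lam ≤ 1 := by
  obtain ⟨x, y, hxy⟩ := exists_pair_ne (State d)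
  obtain ⟨m, hm⟩ := Function.ne_iff.1 hxy
  set v : Block d m := x m - y m
  have hv : 0 < ‖v‖ := norm_pos_iff.2 (sub_ne_zero.2 hm)
  have h1 := h.update_le m 0 v
  have h2 := h.fderiv_add_le 0 (Pi.single m v)
  have e : Function.update (0 : State d) m ((0 : State d) m + v) = 0 + Pi.single m v := by
    simp [Pi.single]
  have e2 : ∑ i, L i * ‖(Pi.single m v : State d) i‖ ^ 2 = L m * ‖v‖ ^ 2 := by
    rw [Finset.sum_eq_single m]
    · simp
    · intro i _ hi
      simp [hi]
    · simp
  rw [e] at h1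
  rw [e2] at h2
  have hp : 0 < L m * ‖v‖ ^ 2 := mul_pos (h.L_pos m) (by positivity)
  nlinarith

/-- For `U₀`, the block-wise linear terms add up to `t` times the full derivative along `y - x`, and
`t ≤ lam` lets strong convexity absorb the quadratic terms. For the separable part, block `i` moves
in one of the `M` summands only, so plain convexity suffices. -/
theorem sum_moveTo_le (h : BlockConvexSmooth U U₀ V L lam) {t : ℝ} (h0 : 0 ≤ t) (h1 : t ≤ 1)
    (htl : t ≤ lam) (x y : State d) :
    ∑ m, U (moveTo t m x y) ≤ (M - t) * U x + t * U y := by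
  have hU0 : ∑ m, U₀ (moveTo t m x y) ≤ (M - t) * U₀ x + t * U₀ y := by
    have hm : ∀ m, U₀ (moveTo t m x y) ≤
        U₀ x + t * fderiv ℝ U₀ x (Pi.single m ((y - x) m)) +
          t ^ 2 / 2 * (L m * ‖(y - x) m‖ ^ 2) := by
      intro m
      have := h.update_le m x (t • (y - x) m)
      have e : x m + t • (y - x) m = (1 - t) • x m + t • y m := by
        rw [Pi.sub_apply, smul_sub, sub_smul, one_smul]
        abel
      rw [e, Pi.single_smul, map_smul, norm_smul, Real.norm_of_nonneg h0] at this
      refine this.trans_eq ?_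
      simp only [smul_eq_mul]
      ring
    have hs : ∑ m, fderiv ℝ U₀ x (Pi.single m ((y - x) m)) = fderiv ℝ U₀ x (y - x) := by
      rw [← map_sum, Finset.univ_sum_single]
    have hq : 0 ≤ ∑ m, L m * ‖(y - x) m‖ ^ 2 :=
      Finset.sum_nonneg fun m _ => mul_nonneg (h.L_pos m).le (by positivity)
    have h3 := h.fderiv_add_le x (y - x)
    rw [add_sub_cancel] at h3
    have h4 := Finset.sum_le_sum fun m (_ : m ∈ Finset.univ) => hm m
    rw [Finset.sum_add_distrib, Finset.sum_add_distrib, ← Finset.mul_sum, ← Finset.mul_sum, hs,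
      Finset.sum_const, Finset.card_univ, Fintype.card_fin, nsmul_eq_mul] at h4
    have h5 := mul_le_mul_of_nonneg_left h3 h0
    have h6 : t ^ 2 / 2 * ∑ m, L m * ‖(y - x) m‖ ^ 2 ≤
        t * (lam / 2 * ∑ m, L m * ‖(y - x) m‖ ^ 2) := by
      have := mul_le_mul_of_nonneg_left htl (mul_nonneg h0 hq)
      nlinarith
    nlinarith
  have hV : ∑ m, ∑ i, V i (moveTo t m x y i) ≤
      (M - t) * ∑ i, V i (x i) + t * ∑ i, V i (y i) := by
    rw [Finset.sum_comm, Finset.mul_sum, Finset.mul_sum, ← Finset.sum_add_distrib]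
    refine Finset.sum_le_sum fun i _ => ?_
    rw [← Finset.add_sum_erase _ _ (Finset.mem_univ i)]
    have e : ∑ m ∈ Finset.univ.erase i, V i (moveTo t m x y i) = (M - 1) * V i (x i) := by
      rw [Finset.sum_congr rfl (g := fun _ => V i (x i)) fun m hm => by
        rw [moveTo, Function.update_of_ne (Finset.ne_of_mem_erase hm).symm]]
      rw [Finset.sum_const, Finset.card_erase_of_mem (Finset.mem_univ i), Finset.card_univ,
        Fintype.card_fin, nsmul_eq_mul, Nat.cast_sub (i.pos), Nat.cast_one]
    have hc := (h.convex_sep i).2 (Set.mem_univ (x i)) (Set.mem_univ (y i)) (sub_nonneg.2 h1) h0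
      (by ring)
    rw [e, moveTo, Function.update_self]
    simp only [smul_eq_mul] at hc
    linarith
  simp only [h.decomp, Finset.sum_add_distrib]
  linarith

theorem continuous (h : BlockConvexSmooth U U₀ V L lam) : Continuous U := by
  have : U = fun x => U₀ x + ∑ m, V m (x m) := funext h.decomp
  rw [this]
  refine h.contDiff.continuous.add (continuous_finsetSum _ fun m _ => ?_)
  have hV : Continuous (V m) := continuousOn_univ.1 ((h.convex_sep m).continuousOn isOpen_univ)
  exact hV.comp (continuous_apply m)

end BlockConvexSmooth


/-! ### Gibbs variational inequality -/

theorem toReal_rnDeriv_pos {α : Type*} [MeasurableSpace α] {μ ν : Measure α} [SigmaFinite μ]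
    [SigmaFinite ν] (h : μ ≪ ν) : ∀ᵐ x ∂μ, 0 < (μ.rnDeriv ν x).toReal := by
  filter_upwards [Measure.rnDeriv_pos h, h.ae_le (Measure.rnDeriv_lt_top μ ν)] with x hx hxt
  exact ENNReal.toReal_pos hx.ne' hxt.ne

/-- The Gibbs variational inequality. -/
theorem integral_log_le_klDiv {α : Type*} [MeasurableSpace α] {μ π : Measure α}
    [IsProbabilityMeasure μ] [IsProbabilityMeasure π] (h : klDiv μ π ≠ ∞) {ψ : α → ℝ≥0∞}
    (hψ : Measurable ψ) (hψ1 : ∫⁻ x, ψ x ∂π ≤ 1) (hpos : ∀ᵐ x ∂μ, 0 < (ψ x).toReal)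
    (hint : Integrable (fun x => Real.log (ψ x).toReal) μ) :
    ∫ x, Real.log (ψ x).toReal ∂μ ≤ (klDiv μ π).toReal := by
  obtain ⟨hac, hllr⟩ := klDiv_ne_top_iff.1 h
  rw [toReal_klDiv_of_measure_eq hac (by simp)]
  set r := μ.rnDeriv π with hr
  have hrm : Measurable r := Measure.measurable_rnDeriv _ _
  have hqm : Measurable fun x => ψ x * (r x)⁻¹ := hψ.mul hrm.inv
  have hl : ∫⁻ x, ψ x * (r x)⁻¹ ∂μ ≤ 1 := by
    rw [← lintegral_rnDeriv_mul hac hqm.aemeasurable]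
    refine le_trans (lintegral_mono fun x => ?_) hψ1
    calc r x * (ψ x * (r x)⁻¹) = ψ x * (r x * (r x)⁻¹) := by ring
      _ ≤ ψ x * 1 := by gcongr; exact ENNReal.mul_inv_le_one _
      _ = ψ x := mul_one _
  have hi : Integrable (fun x => (ψ x * (r x)⁻¹).toReal) μ :=
    integrable_toReal_of_lintegral_ne_top hqm.aemeasurable
      (ne_top_of_le_ne_top ENNReal.one_ne_top hl)
  have hi1 : ∫ x, (ψ x * (r x)⁻¹).toReal ∂μ ≤ 1 := by
    rw [integral_toReal hqm.aemeasurable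
      (ae_lt_top hqm (ne_top_of_le_ne_top ENNReal.one_ne_top hl))]
    exact ENNReal.toReal_le_of_le_ofReal zero_le_one (by simpa using hl)
  -- This is `log a ≤ a - 1` for `a = ψ / r`, whose `μ`-integral is at most `∫ ψ dπ ≤ 1`.
  have hle : ∀ᵐ x ∂μ, Real.log (ψ x).toReal ≤ llr μ π x + ((ψ x * (r x)⁻¹).toReal - 1) := by
    filter_upwards [hpos, toReal_rnDeriv_pos hac] with x hx hrx
    have := Real.log_le_sub_one_of_pos (div_pos hx hrx)
    rw [Real.log_div hx.ne' hrx.ne'] at this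
    rw [ENNReal.toReal_mul, ENNReal.toReal_inv, ← div_eq_mul_inv, llr]
    linarith
  have := integral_mono_ae hint (hllr.add (hi.sub (integrable_const 1))) hle
  rw [integral_add' hllr (hi.sub (integrable_const 1)),
    integral_sub' hi (integrable_const 1)] at this
  simp only [integral_const, probReal_univ, smul_eq_mul, mul_one] at this
  linarith

/-! ### Improved subadditivity of the entropy -/

section Core

variable {M : ℕ} {d : Fin M → ℕ} {U U₀ : State d → ℝ} {V : ∀ m, Block d m → ℝ} {L : Fin M → ℝ}
  {lam : ℝ}

theorem rest_update (m : Fin M) (x : State d) (y : Block d m) :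
    rest m (Function.update x m y) = rest m x := by
  funext i
  exact Function.update_of_ne i.2 _ _

/-- The dual form of the entropy inequality. In `lintegral_rpow_le_prod_moveTo` the factor `ρ m
(rest m x)` is unaffected by moving block `m`, so the `ρ m` cancel and only the inequality on `U`
remains to be checked. -/
theorem lintegral_prod_rpow_le_one (h : BlockConvexSmooth U U₀ V L lam)
    [IsProbabilityMeasure (gibbs U)] {ρ : ∀ m, Rest d m → ℝ≥0∞} (hρ : ∀ m, Measurable (ρ m))
    (hρ1 : ∀ m, ∫⁻ x, ρ m (rest m x) ∂(gibbs U) ≤ 1)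
    (hM : 1 ≤ M) {t : ℝ} (h0 : 0 < t) (h1 : t < 1) (htl : t ≤ lam) :
    ∫⁻ x, (∏ m, ρ m (rest m x)) ^ (M - t)⁻¹ ∂(gibbs U) ≤ 1 := by
  have hM' : (1 : ℝ) ≤ M := by exact_mod_cast hM
  have hr : 0 < (M : ℝ) - t := by linarith
  set e : State d → ℝ≥0∞ := fun x => ENNReal.ofReal (Real.exp (-U x)) with he
  have hem : Measurable e :=
    (Real.continuous_exp.comp h.continuous.neg).measurable.ennreal_ofReal
  have hρm : ∀ m, Measurable fun x : State d => ρ m (rest m x) := fun m =>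
    (hρ m).comp (measurable_rest m)
  have hψm : Measurable fun x : State d => (∏ m, ρ m (rest m x)) ^ (M - t)⁻¹ :=
    (Finset.measurable_fun_prod _ fun m _ => hρm m).pow_const _
  have hint : ∀ {φ : State d → ℝ≥0∞}, Measurable φ → ∫⁻ x, φ x ∂(gibbs U) = ∫⁻ x, e x * φ x :=
    fun hφ => lintegral_withDensity_eq_lintegral_mul _ hem hφ
  have he1 : ∫⁻ x, e x = 1 := by
    have := hint (measurable_const (a := (1 : ℝ≥0∞)))
    simpa using this.symm
  have key := lintegral_rpow_le_prod_moveTo (f := fun x => e x * (∏ m, ρ m (rest m x)) ^ (M - t)⁻¹)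
    (g := e) (F := fun m x => e x * ρ m (rest m x)) (hem.mul hψm) hem (fun m => hem.mul (hρm m))
    h0 h1 fun x y => by
      have e1 : ∀ m, rest m (moveTo t m x y) = rest m x := fun m => rest_update m x _
      simp only [e1]
      rw [ENNReal.mul_rpow_of_nonneg _ _ hr.le, ENNReal.rpow_inv_rpow hr.ne',
        Finset.prod_mul_distrib, mul_right_comm]
      gcongr
      simp only [he]
      rw [← ENNReal.ofReal_prod_of_nonneg fun m _ => (Real.exp_pos _).le,
        ENNReal.ofReal_rpow_of_pos (Real.exp_pos _), ENNReal.ofReal_rpow_of_pos (Real.exp_pos _),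
        ← ENNReal.ofReal_mul (by positivity), ← Real.exp_mul, ← Real.exp_mul, ← Real.exp_add,
        ← Real.exp_sum, Finset.sum_neg_distrib]
      refine ENNReal.ofReal_le_ofReal (Real.exp_le_exp.2 ?_)
      have := h.sum_moveTo_le h0.le h1.le htl x y
      linarith
  rw [he1, ENNReal.one_rpow, mul_one, ← hint hψm] at key
  have : (∫⁻ x, (∏ m, ρ m (rest m x)) ^ (M - t)⁻¹ ∂(gibbs U)) ^ (M - t) ≤ 1 := by
    refine key.trans (Finset.prod_le_one' fun m _ => ?_)
    rw [← hint (hρm m)]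
    exact hρ1 m
  rwa [← ENNReal.one_rpow (M - t), ENNReal.rpow_le_rpow_iff hr] at this

theorem sum_klDiv_rest_le_of_lt_one (h : BlockConvexSmooth U U₀ V L lam)
    [IsProbabilityMeasure (gibbs U)] (hM : 1 ≤ M) (μ : Measure (State d)) [IsProbabilityMeasure μ]
    (hKL : klDiv μ (gibbs U) ≠ ∞) {t : ℝ} (h0 : 0 < t) (h1 : t < 1) (htl : t ≤ lam) :
    ∑ m, (klDiv (μ.map (rest m)) ((gibbs U).map (rest m))).toReal ≤
      (M - t) * (klDiv μ (gibbs U)).toReal := by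
  have hM' : (1 : ℝ) ≤ M := by exact_mod_cast hM
  have hr : 0 < (M : ℝ) - t := by linarith
  have hpμ : ∀ m, IsProbabilityMeasure (μ.map (rest m)) := fun m =>
    Measure.isProbabilityMeasure_map (measurable_rest m).aemeasurable
  have hpπ : ∀ m, IsProbabilityMeasure ((gibbs U).map (rest m)) := fun m =>
    Measure.isProbabilityMeasure_map (measurable_rest m).aemeasurable
  set ρ : ∀ m, Rest d m → ℝ≥0∞ := fun m => (μ.map (rest m)).rnDeriv ((gibbs U).map (rest m))
    with hρdef
  have hρ : ∀ m, Measurable (ρ m) := fun m => Measure.measurable_rnDeriv _ _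
  have hK : ∀ m, klDiv (μ.map (rest m)) ((gibbs U).map (rest m)) ≠ ∞ := fun m =>
    ne_top_of_le_ne_top hKL (klDiv_map_le _ _ (measurable_rest m))
  have hac : ∀ m, μ.map (rest m) ≪ (gibbs U).map (rest m) := fun m =>
    (klDiv_ne_top_iff.1 (hK m)).1
  have hρ1 : ∀ m, ∫⁻ x, ρ m (rest m x) ∂(gibbs U) ≤ 1 := fun m => by
    have := hpμ m
    have := hpπ m
    rw [← lintegral_map (hρ m) (measurable_rest m)]
    exact Measure.lintegral_rnDeriv_le.trans measure_univ.le
  have hpos : ∀ᵐ x ∂μ, ∀ m, 0 < (ρ m (rest m x)).toReal :=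
    ae_all_iff.2 fun m => by
      have := hpμ m
      have := hpπ m
      exact ae_of_ae_map (measurable_rest m).aemeasurable (toReal_rnDeriv_pos (hac m))
  have hint : ∀ m, Integrable (fun x => Real.log (ρ m (rest m x)).toReal) μ := fun m =>
    ((klDiv_ne_top_iff.1 (hK m)).2).comp_measurable (measurable_rest m)
  have hval : ∀ m, ∫ x, Real.log (ρ m (rest m x)).toReal ∂μ =
      (klDiv (μ.map (rest m)) ((gibbs U).map (rest m))).toReal := fun m => by
    rw [toReal_klDiv_of_measure_eq (hac m) (by simp),
      integral_map (measurable_rest m).aemeasurable (measurable_llr _ _).aestronglyMeasurable]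
    rfl
  have hlog : ∀ᵐ x ∂μ, Real.log ((∏ m, ρ m (rest m x)) ^ (M - t)⁻¹).toReal =
      (M - t)⁻¹ * ∑ m, Real.log (ρ m (rest m x)).toReal := by
    filter_upwards [hpos] with x hx
    rw [← ENNReal.toReal_rpow, ENNReal.toReal_prod,
      Real.log_rpow (Finset.prod_pos fun m _ => hx m), Real.log_prod fun m _ => (hx m).ne']
  have key := integral_log_le_klDiv hKL
    (ψ := fun x => (∏ m, ρ m (rest m x)) ^ (M - t)⁻¹)
    ((Finset.measurable_fun_prod _ fun m _ => (hρ m).comp (measurable_rest m)).pow_const _)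
    (lintegral_prod_rpow_le_one h hρ hρ1 hM h0 h1 htl) (by
      filter_upwards [hpos] with x hx
      rw [← ENNReal.toReal_rpow, ENNReal.toReal_prod]
      exact Real.rpow_pos_of_pos (Finset.prod_pos fun m _ => hx m) _)
    ((integrable_congr hlog).2 ((integrable_finsetSum _ fun m _ => hint m).const_mul _))
  rw [integral_congr_ae hlog, integral_const_mul, integral_finsetSum _ fun m _ => hint m] at key
  simp only [hval] at key
  rwa [inv_mul_le_iff₀ hr] at key

/-- Subadditivity of the entropy improved by block-wise strong convexity. -/
theorem sum_klDiv_rest_le (h : BlockConvexSmooth U U₀ V L lam)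
    [IsProbabilityMeasure (gibbs U)] (hM : 1 ≤ M) (μ : Measure (State d)) [IsProbabilityMeasure μ]
    (hKL : klDiv μ (gibbs U) ≠ ∞) :
    ∑ m, (klDiv (μ.map (rest m)) ((gibbs U).map (rest m))).toReal ≤
      (M - lam) * (klDiv μ (gibbs U)).toReal := by
  -- If all blocks have dimension 0, `lam` may exceed 1, but then `μ` equals the target and both
  -- sides vanish. Otherwise `lam ≤ 1`, and the bound for `t < lam` passes to the limit, which
  -- covers `lam = 1`.
  rcases subsingleton_or_nontrivial (State d) with hs | hn
  · have e : μ = gibbs U := by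
      ext s _
      rcases s.eq_empty_or_nonempty with rfl | hne
      · simp
      · rw [Subsingleton.eq_univ_of_nonempty hne]
        simp
    simp [e]
  · have hlam := h.le_one
    have ht : Filter.Tendsto (fun t : ℝ => (M - t) * (klDiv μ (gibbs U)).toReal)
        (nhdsWithin lam (Set.Iio lam)) (nhds ((M - lam) * (klDiv μ (gibbs U)).toReal)) :=
      (Continuous.tendsto (by fun_prop) lam).mono_left nhdsWithin_le_nhds
    refine ge_of_tendsto ht ?_
    filter_upwards [Ioo_mem_nhdsLT h.lam_pos] with t htt
    exact sum_klDiv_rest_le_of_lt_one h hM μ hKL htt.1 (htt.2.trans_le hlam) htt.2.le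

end Core


/-! ### Conditional divergence and its contraction -/

section CondKL

variable {α γ : Type*} {mα : MeasurableSpace α} {mγ : MeasurableSpace γ}
  [MeasurableSpace.CountableOrCountablyGenerated α γ]

theorem klDiv_eq_lintegral_kernel_rnDeriv (κ η : Kernel α γ) [IsFiniteKernel κ] [IsFiniteKernel η]
    {a : α} (h : κ a ≪ η a) :
    klDiv (κ a) (η a) = ∫⁻ x, ENNReal.ofReal (klFun (κ.rnDeriv η a x).toReal) ∂(η a) := by
  rw [klDiv_eq_lintegral_klFun_of_ac h]
  refine lintegral_congr_ae ?_
  filter_upwards [Kernel.rnDeriv_eq_rnDeriv_measure (κ := κ) (η := η) (a := a)] with x hx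
  rw [hx]

/-- The jointly measurable `Kernel.rnDeriv` supplies a measurable version. It is needed to infer
almost everywhere finiteness from a finite integral. -/
theorem aemeasurable_klDiv_kernel {μ : Measure α} (κ η : Kernel α γ) [IsFiniteKernel κ]
    [IsFiniteKernel η] (h : ∀ᵐ a ∂μ, κ a ≪ η a) :
    AEMeasurable (fun a => klDiv (κ a) (η a)) μ := by
  refine ⟨fun a => ∫⁻ x, ENNReal.ofReal (klFun (κ.rnDeriv η a x).toReal) ∂(η a), ?_, ?_⟩
  · refine Measurable.lintegral_kernel_prod_right ?_
    exact (measurable_klFun.comp (Kernel.measurable_rnDeriv κ η).ennreal_toReal).ennreal_ofReal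
  · filter_upwards [h] with a ha using klDiv_eq_lintegral_kernel_rnDeriv κ η ha

/-- The conditional Kullback–Leibler divergence as an average over the conditioning variable. -/
theorem klDiv_compProd_right {μ : Measure α} [IsFiniteMeasure μ] (κ η : Kernel α γ)
    [IsFiniteKernel κ] [IsFiniteKernel η] (h : ∀ᵐ a ∂μ, κ a ≪ η a) :
    klDiv (μ ⊗ₘ κ) (μ ⊗ₘ η) = ∫⁻ a, klDiv (κ a) (η a) ∂μ := by
  have hm := Kernel.measurable_rnDeriv κ η
  have e : μ ⊗ₘ κ = (μ ⊗ₘ η).withDensity fun p => κ.rnDeriv η p.1 p.2 := by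
    rw [← Measure.compProd_withDensity hm]
    refine Measure.compProd_congr ?_
    filter_upwards [h] with a ha using (Kernel.withDensity_rnDeriv_eq ha).symm
  rw [klDiv_eq_lintegral_klFun_of_ac (Measure.AbsolutelyContinuous.compProd_right h)]
  have hr : (μ ⊗ₘ κ).rnDeriv (μ ⊗ₘ η) =ᵐ[μ ⊗ₘ η] fun p => κ.rnDeriv η p.1 p.2 := by
    rw [e]
    exact Measure.rnDeriv_withDensity _ hm
  rw [lintegral_congr_ae (hr.mono fun p hp => by rw [hp])]
  have hkm : Measurable fun p : α × γ => ENNReal.ofReal (klFun (κ.rnDeriv η p.1 p.2).toReal) :=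
    (measurable_klFun.comp hm.ennreal_toReal).ennreal_ofReal
  rw [Measure.lintegral_compProd hkm]
  refine lintegral_congr_ae ?_
  filter_upwards [h] with a ha using (klDiv_eq_lintegral_kernel_rnDeriv κ η ha).symm

/-- Real multiples of finite extended nonnegative numbers, without subtraction. -/
theorem add_le_of_coe_le_mul {a b : ℝ≥0∞} {β : ℝ} (hb : b ≠ ∞)
    (h : (a : EReal) ≤ ((1 - β : ℝ) : EReal) * (b : EReal)) :
    a ≠ ∞ ∧ a + ENNReal.ofReal (β - 1) * b ≤ ENNReal.ofReal (1 - β) * b := by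
  lift b to NNReal using hb
  have e : ((1 - β : ℝ) : EReal) * ((b : ℝ≥0∞) : EReal) = (((1 - β) * b : ℝ) : EReal) := by
    rw [EReal.coe_mul]
    rfl
  rw [e] at h
  have ha : a ≠ ∞ := by
    rintro rfl
    exact absurd h (not_le.2 (EReal.coe_lt_top _))
  lift a to NNReal using ha
  refine ⟨ENNReal.coe_ne_top, ?_⟩
  have h' : (a : ℝ) ≤ (1 - β) * b := EReal.coe_le_coe_iff.1 h
  have hab : ∀ c : ℝ, 0 ≤ c → ENNReal.ofReal c * (b : ℝ≥0∞) = ENNReal.ofReal (c * b) := by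
    intro c hc
    rw [ENNReal.ofReal_mul hc, ENNReal.ofReal_coe_nnreal]
  have haa : (a : ℝ≥0∞) = ENNReal.ofReal a := (ENNReal.ofReal_coe_nnreal).symm
  rcases le_total β 1 with h1 | h1
  · rw [ENNReal.ofReal_of_nonpos (by linarith), zero_mul, add_zero, hab _ (by linarith), haa]
    exact ENNReal.ofReal_le_ofReal h'
  · rw [ENNReal.ofReal_of_nonpos (show 1 - β ≤ 0 by linarith), zero_mul, hab _ (by linarith), haa,
      ← ENNReal.ofReal_add a.coe_nonneg (mul_nonneg (by linarith) b.coe_nonneg)]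
    rw [ENNReal.ofReal_of_nonpos (by linarith)]

theorem toReal_le_of_add_le {a b : ℝ≥0∞} {β : ℝ} (hb : b ≠ ∞)
    (h : a + ENNReal.ofReal (β - 1) * b ≤ ENNReal.ofReal (1 - β) * b) :
    a ≠ ∞ ∧ a.toReal ≤ (1 - β) * b.toReal := by
  have ht : ENNReal.ofReal (1 - β) * b ≠ ∞ := ENNReal.mul_ne_top ENNReal.ofReal_ne_top hb
  have ht' : ENNReal.ofReal (β - 1) * b ≠ ∞ := ENNReal.mul_ne_top ENNReal.ofReal_ne_top hb
  have ha : a ≠ ∞ := ne_top_of_le_ne_top ht (le_self_add.trans h)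
  refine ⟨ha, ?_⟩
  have h2 := ENNReal.toReal_mono ht h
  rw [ENNReal.toReal_add ha ht', ENNReal.toReal_mul, ENNReal.toReal_mul] at h2
  rcases le_total β 1 with h1 | h1
  · rw [ENNReal.ofReal_of_nonpos (show β - 1 ≤ 0 by linarith),
      ENNReal.toReal_ofReal (by linarith)] at h2
    simpa using h2
  · rw [ENNReal.ofReal_of_nonpos (show 1 - β ≤ 0 by linarith),
      ENNReal.toReal_ofReal (by linarith)] at h2
    simp only [ENNReal.toReal_zero, zero_mul] at h2
    linarith

/-- Contraction of the conditional distributions improves the divergence of the joint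
distribution, up to the divergence of the first marginals. -/
theorem klDiv_compProd_le_of_forall {μ π : Measure α} [IsProbabilityMeasure μ]
    [IsProbabilityMeasure π] (κ κ' η : Kernel α γ) [IsMarkovKernel κ] [IsMarkovKernel κ']
    [IsMarkovKernel η] (hK : klDiv (μ ⊗ₘ κ) (π ⊗ₘ η) ≠ ∞) {β : ℝ}
    (hβ : ∀ᵐ a ∂μ, klDiv (κ a) (η a) < ∞ → (klDiv (κ' a) (η a) : EReal) ≤
      ((1 - β : ℝ) : EReal) * (klDiv (κ a) (η a) : EReal)) :
    klDiv (μ ⊗ₘ κ') (π ⊗ₘ η) ≠ ∞ ∧ (klDiv (μ ⊗ₘ κ') (π ⊗ₘ η)).toReal ≤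
      (1 - β) * (klDiv (μ ⊗ₘ κ) (π ⊗ₘ η)).toReal + β * (klDiv μ π).toReal := by
  rw [klDiv_compProd_eq_add] at hK
  rw [klDiv_compProd_eq_add (κ := κ'), klDiv_compProd_eq_add (κ := κ) (ν := π)]
  obtain ⟨hK1, hK2⟩ := ENNReal.add_ne_top.1 hK
  have hac : ∀ᵐ a ∂μ, κ a ≪ η a :=
    ((klDiv_ne_top_iff.1 hK2).1).kernel_of_compProd
  have e := klDiv_compProd_right κ η hac
  rw [e] at hK2
  have hle : ∀ᵐ a ∂μ, klDiv (κ' a) (η a) ≠ ∞ ∧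
      klDiv (κ' a) (η a) + ENNReal.ofReal (β - 1) * klDiv (κ a) (η a) ≤
        -- The sign of `1 - β` is unknown. Writing it as a difference of two nonnegative
        -- coefficients, one on each side, allows integration in `ℝ≥0∞`.
        ENNReal.ofReal (1 - β) * klDiv (κ a) (η a) := by
    filter_upwards [hβ, ae_lt_top' (aemeasurable_klDiv_kernel κ η hac) hK2] with a ha hat
    exact add_le_of_coe_le_mul hat.ne (ha hat)
  have hac' : ∀ᵐ a ∂μ, κ' a ≪ η a := hle.mono fun a ha => (klDiv_ne_top_iff.1 ha.1).1
  have e' := klDiv_compProd_right κ' η hac'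
  have key : klDiv (μ ⊗ₘ κ') (μ ⊗ₘ η) + ENNReal.ofReal (β - 1) * klDiv (μ ⊗ₘ κ) (μ ⊗ₘ η) ≤
      ENNReal.ofReal (1 - β) * klDiv (μ ⊗ₘ κ) (μ ⊗ₘ η) := by
    rw [e, e', ← lintegral_const_mul' _ _ ENNReal.ofReal_ne_top,
      ← lintegral_const_mul' _ _ ENNReal.ofReal_ne_top]
    exact (le_lintegral_add _ _).trans (lintegral_mono_ae (hle.mono fun a ha => ha.2))
  rw [← e] at hK2
  obtain ⟨h1, h2⟩ := toReal_le_of_add_le hK2 key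
  refine ⟨ENNReal.add_ne_top.2 ⟨hK1, h1⟩, ?_⟩
  rw [ENNReal.toReal_add hK1 h1, ENNReal.toReal_add hK1 hK2]
  linarith

end CondKL

theorem klDiv_map_measurableEquiv {α γ : Type*} [MeasurableSpace α] [MeasurableSpace γ]
    (e : α ≃ᵐ γ) (μ π : Measure α) [IsFiniteMeasure μ] [IsFiniteMeasure π] :
    klDiv (μ.map e) (π.map e) = klDiv μ π := by
  refine le_antisymm (klDiv_map_le _ _ e.measurable) ?_
  have := klDiv_map_le (μ.map e) (π.map e) e.symm.measurable
  simpa [Measure.map_map e.symm.measurable e.measurable] using this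

/-- Convexity of the Kullback–Leibler divergence in its first argument. -/
theorem klDiv_average_le {α : Type*} [MeasurableSpace α] {M : ℕ} (hM : 1 ≤ M)
    (μ : Fin M → Measure α) [∀ m, IsProbabilityMeasure (μ m)] (π : Measure α)
    [IsProbabilityMeasure π] (h : ∀ m, μ m ≪ π) :
    klDiv ((M : ℝ≥0∞)⁻¹ • ∑ m, μ m) π ≤ (M : ℝ≥0∞)⁻¹ * ∑ m, klDiv (μ m) π := by
  have hM0 : (M : ℝ≥0∞) ≠ 0 := by exact_mod_cast (by omega : M ≠ 0)
  -- The average is the second marginal of the joint law of a uniform index and a draw from `μ m`;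
  -- forgetting the index can only decrease the divergence.
  let u : Measure (Fin M) := (M : ℝ≥0∞)⁻¹ • Measure.count
  have hu : IsProbabilityMeasure u := ⟨by
    simp [u, Measure.count_apply, ENNReal.inv_mul_cancel hM0 (ENNReal.natCast_ne_top M)]⟩
  let κ : Kernel (Fin M) α := ⟨μ, measurable_of_finite _⟩
  have hκ : IsMarkovKernel κ := ⟨fun m => inferInstanceAs (IsProbabilityMeasure (μ m))⟩
  have hint : ∀ φ : Fin M → ℝ≥0∞, ∫⁻ m, φ m ∂u = (M : ℝ≥0∞)⁻¹ * ∑ m, φ m := by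
    intro φ
    rw [lintegral_smul_measure, lintegral_count, tsum_fintype, smul_eq_mul]
  have e1 : (u ⊗ₘ κ).snd = (M : ℝ≥0∞)⁻¹ • ∑ m, μ m := by
    ext s hs
    rw [Measure.snd_compProd, Measure.bind_apply hs κ.measurable.aemeasurable, hint]
    simp [κ]
  have e2 : (u ⊗ₘ Kernel.const (Fin M) π).snd = π := by
    rw [Measure.snd_compProd]
    simp
  have := klDiv_map_le (u ⊗ₘ κ) (u ⊗ₘ Kernel.const (Fin M) π) measurable_snd
  rw [← Measure.snd, ← Measure.snd, e1, e2, klDiv_compProd_right _ _ (ae_of_all _ h), hint] at this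
  exact this


/-! ### Disintegration of the Gibbs measure along one block -/

variable {M : ℕ} {d : Fin M → ℕ}

/-- The complement of the complement of `m` is a singleton. -/
abbrev uniqueNotNe (m : Fin M) : Unique {i : Fin M // ¬ i ≠ m} :=
  ⟨⟨⟨m, by simp⟩⟩, fun i => Subtype.ext (not_not.1 i.2)⟩

/-- The identification `x ↦ (x_{-m}, x_m)`. -/
noncomputable def splitEquiv (d : Fin M → ℕ) (m : Fin M) : State d ≃ᵐ Rest d m × Block d m :=
  letI := uniqueNotNe m
  (MeasurableEquiv.piEquivPiSubtypeProd (fun i => Block d i) (fun i => i ≠ m)).trans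
    (MeasurableEquiv.prodCongr (MeasurableEquiv.refl _)
      (MeasurableEquiv.piUnique fun i : {i : Fin M // ¬ i ≠ m} => Block d i.1))

theorem splitEquiv_apply (m : Fin M) (x : State d) : splitEquiv d m x = (rest m x, x m) := rfl

theorem measurePreserving_splitEquiv (m : Fin M) : MeasurePreserving (splitEquiv d m) := by
  let := uniqueNotNe m
  exact ((MeasurePreserving.id _).prod (volume_preserving_piUnique
    fun i : {i : Fin M // ¬ i ≠ m} => Block d i.1)).comp
    (volume_preserving_piEquivPiSubtypeProd (fun i => Block d i) (fun i => i ≠ m))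

theorem splitEquiv_update (m : Fin M) (x : State d) (y : Block d m) :
    splitEquiv d m (Function.update x m y) = (rest m x, y) := by
  rw [splitEquiv_apply, rest_update, Function.update_self]

/-- The state with `m`-th block `y` and other blocks `r`. -/
noncomputable def join (m : Fin M) (r : Rest d m) (y : Block d m) : State d :=
  (splitEquiv d m).symm (r, y)

theorem rest_join (m : Fin M) (r : Rest d m) (y : Block d m) : rest m (join m r y) = r :=
  congrArg Prod.fst ((splitEquiv d m).apply_symm_apply (r, y))

theorem update_join (m : Fin M) (r : Rest d m) (y z : Block d m) :
    Function.update (join m r y) m z = join m r z := by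
  apply (splitEquiv d m).injective
  rw [splitEquiv_update, rest_join, join, MeasurableEquiv.apply_symm_apply]

/-- The conditional distribution of the `m`-th block as a kernel. -/
noncomputable def conditionalKernel (U : State d → ℝ) (m : Fin M) : Kernel (Rest d m) (Block d m) :=
  (Kernel.const (Rest d m) (volume : Measure (Block d m))).withDensity fun r y =>
    (∫⁻ z, ENNReal.ofReal (Real.exp (-U (join m r z))))⁻¹ *
      ENNReal.ofReal (Real.exp (-U (join m r y)))

theorem measurable_exp_join {U : State d → ℝ} (hU : Measurable U) (m : Fin M) :
    Measurable fun p : Rest d m × Block d m =>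
    ENNReal.ofReal (Real.exp (-U (join m p.1 p.2))) :=
  ((hU.comp (splitEquiv d m).symm.measurable).neg.exp).ennreal_ofReal

theorem measurable_density {U : State d → ℝ} (hU : Measurable U) (m : Fin M) :
    Measurable (Function.uncurry fun (r : Rest d m) (y : Block d m) =>
    (∫⁻ z, ENNReal.ofReal (Real.exp (-U (join m r z))))⁻¹ *
      ENNReal.ofReal (Real.exp (-U (join m r y)))) :=
  ((measurable_exp_join hU m).lintegral_prod_right'.inv.comp measurable_fst).mul
    (measurable_exp_join hU m)

theorem conditionalKernel_apply {U : State d → ℝ} (hU : Measurable U) (m : Fin M)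
    (r : Rest d m) (y : Block d m) :
    conditionalKernel U m r = fullConditional U m (join m r y) := by
  rw [conditionalKernel, Kernel.withDensity_apply _ (measurable_density hU m), Kernel.const_apply,
    fullConditional]
  simp only [update_join]
  have h := (measurable_exp_join hU m).comp (measurable_prodMk_left (x := r))
  exact withDensity_smul _ h

/-- Only finiteness is claimed: where the normalising integral is infinite, its inverse is 0 and so
is the measure. -/
theorem isFiniteKernel_conditionalKernel {U : State d → ℝ} (hU : Measurable U) (m : Fin M) :
    IsFiniteKernel (conditionalKernel U m) := by
  refine ⟨1, ENNReal.one_lt_top, fun r => ?_⟩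
  rw [conditionalKernel_apply hU m r 0, fullConditional]
  simp only [update_join, Measure.smul_apply, withDensity_apply _ MeasurableSet.univ,
    Measure.restrict_univ, smul_eq_mul]
  exact ENNReal.inv_mul_le_one _

/-- Disintegration of the Gibbs measure along the `m`-th block. -/
theorem gibbs_map_splitEquiv {U : State d → ℝ} (hU : Measurable U) (m : Fin M)
    [IsProbabilityMeasure (gibbs U)] :
    (gibbs U).map (splitEquiv d m) =
      ((gibbs U).map (rest m)) ⊗ₘ conditionalKernel U m := by
  have := isFiniteKernel_conditionalKernel hU m
  have hp : IsProbabilityMeasure ((gibbs U).map (rest m)) :=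
    Measure.isProbabilityMeasure_map (measurable_rest m).aemeasurable
  set w : Rest d m × Block d m → ℝ≥0∞ := fun p =>
    ENNReal.ofReal (Real.exp (-U (join m p.1 p.2))) with hw
  have hwm : Measurable w := measurable_exp_join hU m
  have hws : ∀ r, Measurable fun y => w (r, y) := fun r => hwm.comp measurable_prodMk_left
  have hum : Measurable fun x : State d => ENNReal.ofReal (Real.exp (-U x)) :=
    hU.neg.exp.ennreal_ofReal
  have hint : ∀ {φ : Rest d m × Block d m → ℝ≥0∞}, Measurable φ →
      ∫⁻ x, φ (splitEquiv d m x) ∂(gibbs U) = ∫⁻ r, ∫⁻ y, w (r, y) * φ (r, y) := by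
    intro φ hφ
    have hφs : Measurable fun x => φ (splitEquiv d m x) := hφ.comp (splitEquiv d m).measurable
    rw [gibbs, lintegral_withDensity_eq_lintegral_mul _ hum hφs]
    have e : ∀ x : State d, ((fun x : State d => ENNReal.ofReal (Real.exp (-U x))) *
        fun x => φ (splitEquiv d m x)) x = (w * φ) (splitEquiv d m x) := by
      intro x
      have : join m (splitEquiv d m x).1 (splitEquiv d m x).2 = x :=
        (splitEquiv d m).symm_apply_apply x
      simp only [Pi.mul_apply, hw, this]
    rw [lintegral_congr e, (measurePreserving_splitEquiv m).lintegral_comp (hwm.mul hφ),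
      Measure.volume_eq_prod, lintegral_prod _ (hwm.mul hφ).aemeasurable]
    rfl
  set Z : Rest d m → ℝ≥0∞ := fun r => ∫⁻ y, w (r, y) with hZ
  have hZm : Measurable Z := hwm.lintegral_prod_right'
  have hZ0 : ∀ r, Z r ≠ 0 := by
    intro r hr
    have h0 := (lintegral_eq_zero_iff (hws _)).1 hr
    obtain ⟨y, hy⟩ := h0.exists
    exact absurd hy (by simp [hw, Real.exp_pos])
  -- The normalising integral `Z` integrates to the total mass 1 of the Gibbs measure.
  have hZt : ∀ᵐ r, Z r < ∞ := by
    refine ae_lt_top hZm ?_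
    have := hint (measurable_const (a := (1 : ℝ≥0∞)))
    simp only [lintegral_const, measure_univ, mul_one] at this
    rw [hZ, ← this]
    exact ENNReal.one_ne_top
  refine Measure.ext_of_lintegral _ fun φ hφ => ?_
  have hψ : Measurable fun r => ∫⁻ y, φ (r, y) ∂(conditionalKernel U m r) :=
    hφ.lintegral_kernel_prod_right'
  rw [lintegral_map hφ (splitEquiv d m).measurable, hint hφ, Measure.lintegral_compProd hφ,
    lintegral_map hψ (measurable_rest m)]
  have e := hint (hψ.comp measurable_fst)
  simp only [Function.comp_def, splitEquiv_apply] at e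
  rw [e]
  refine lintegral_congr_ae ?_
  filter_upwards [hZt] with r hr
  have hφr : Measurable fun y => φ (r, y) := hφ.comp measurable_prodMk_left
  rw [lintegral_mul_const _ (hws _), conditionalKernel,
    Kernel.lintegral_withDensity _ (measurable_density hU m) _ hφr, Kernel.const_apply]
  simp only [mul_assoc]
  have hprod : Measurable fun y => w (r, y) * φ (r, y) := (hws r).mul hφr
  change _ = Z r * ∫⁻ y, (Z r)⁻¹ * (w (r, y) * φ (r, y))
  rw [lintegral_const_mul _ hprod, ← mul_assoc, ENNReal.mul_inv_cancel (hZ0 r) hr.ne, one_mul]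


/-! ### One-block updates and their average -/

instance isMarkovKernel_coordKernel (m : Fin M) (Q : Kernel (Rest d m × Block d m) (Block d m))
    [IsMarkovKernel Q] : IsMarkovKernel (coordKernel m Q) :=
  ⟨fun x => Measure.isProbabilityMeasure_map (μ := Q (rest m x, x m))
    (measurable_update x).aemeasurable⟩

/-- The update keeps the marginal `ν` of the other blocks and replaces the conditional law `κ r` by
its image under `Q`; the chain rule can then compare both joint laws. -/
theorem bind_coordKernel_map_splitEquiv (m : Fin M)
    (Q : Kernel (Rest d m × Block d m) (Block d m)) [IsMarkovKernel Q] (μ : Measure (State d))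
    (ν : Measure (Rest d m)) [IsProbabilityMeasure ν] (κ : Kernel (Rest d m) (Block d m))
    [IsMarkovKernel κ] (hμ : μ.map (splitEquiv d m) = ν ⊗ₘ κ) :
    (μ.bind (coordKernel m Q)).map (splitEquiv d m) = ν ⊗ₘ Kernel.snd (κ ⊗ₖ Q) := by
  refine Measure.ext_of_lintegral _ fun φ hφ => ?_
  have hφs : Measurable fun x => φ (splitEquiv d m x) := hφ.comp (splitEquiv d m).measurable
  have hG : Measurable fun p : Rest d m × Block d m => ∫⁻ y, φ (p.1, y) ∂(Q p) :=
    Measurable.lintegral_kernel_prod_right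
      (hφ.comp ((measurable_fst.comp measurable_fst).prodMk measurable_snd))
  have e : ∀ x, ∫⁻ z, φ (splitEquiv d m z) ∂(coordKernel m Q x) =
      ∫⁻ y, φ ((splitEquiv d m x).1, y) ∂(Q (splitEquiv d m x)) := by
    intro x
    change ∫⁻ z, φ (splitEquiv d m z) ∂((Q (rest m x, x m)).map (Function.update x m)) = _
    rw [lintegral_map hφs (measurable_update x)]
    simp only [splitEquiv_update]
    rfl
  rw [lintegral_map hφ (splitEquiv d m).measurable,
    Measure.lintegral_bind (coordKernel m Q).measurable.aemeasurable hφs.aemeasurable,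
    lintegral_congr e, ← lintegral_map hG (splitEquiv d m).measurable, hμ,
    Measure.lintegral_compProd hG, Measure.lintegral_compProd hφ]
  refine lintegral_congr fun r => ?_
  have hφr : Measurable fun y => φ (r, y) := hφ.comp measurable_prodMk_left
  rw [Kernel.lintegral_snd _ _ hφr,
    Kernel.lintegral_compProd _ _ _ (f := fun p : Block d m × Block d m => φ (r, p.2))
      (hφr.comp measurable_snd)]

theorem snd_compProd_apply (m : Fin M) (Q : Kernel (Rest d m × Block d m) (Block d m))
    [IsMarkovKernel Q] (κ : Kernel (Rest d m) (Block d m)) [IsMarkovKernel κ] (r : Rest d m) :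
    Kernel.snd (κ ⊗ₖ Q) r = (κ r).bind (Q.sectR r) := by
  ext s hs
  rw [Kernel.snd_apply' _ _ hs, Kernel.compProd_apply (measurable_snd hs),
    Measure.bind_apply hs (Q.sectR r).measurable.aemeasurable]
  rfl

/-- Contraction of the conditional updates gives contraction of the update of one block, up to
the divergence of the marginals of the other blocks. -/
theorem klDiv_bind_coordKernel_le {U : State d → ℝ} (hU : Measurable U)
    [IsProbabilityMeasure (gibbs U)] (m : Fin M)
    (Q : Kernel (Rest d m × Block d m) (Block d m)) [IsMarkovKernel Q] {β : ℝ}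
    (hβ : ∀ (x : State d) (ν : Measure (Block d m)),
      IsProbabilityMeasure ν → klDiv ν (fullConditional U m x) < ∞ →
      (klDiv (ν.bind (Q.sectR (rest m x))) (fullConditional U m x) : EReal) ≤
        ((1 - β : ℝ) : EReal) * (klDiv ν (fullConditional U m x) : EReal))
    (μ : Measure (State d)) [IsProbabilityMeasure μ] (hK : klDiv μ (gibbs U) ≠ ∞) :
    klDiv (μ.bind (coordKernel m Q)) (gibbs U) ≠ ∞ ∧
      (klDiv (μ.bind (coordKernel m Q)) (gibbs U)).toReal ≤
        (1 - β) * (klDiv μ (gibbs U)).toReal +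
          β * (klDiv (μ.map (rest m)) ((gibbs U).map (rest m))).toReal := by
  have hs := (splitEquiv d m).measurable
  have hpμ : IsProbabilityMeasure (μ.map (splitEquiv d m)) :=
    Measure.isProbabilityMeasure_map hs.aemeasurable
  have hpπ : IsProbabilityMeasure ((gibbs U).map (splitEquiv d m)) :=
    Measure.isProbabilityMeasure_map hs.aemeasurable
  have hpμ' : IsProbabilityMeasure (μ.map (rest m)) :=
    Measure.isProbabilityMeasure_map (measurable_rest m).aemeasurable
  have hpπ' : IsProbabilityMeasure ((gibbs U).map (rest m)) :=
    Measure.isProbabilityMeasure_map (measurable_rest m).aemeasurable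
  have hfst : ∀ ν : Measure (State d), (ν.map (splitEquiv d m)).fst = ν.map (rest m) := fun ν => by
    rw [Measure.fst, Measure.map_map measurable_fst hs]
    rfl
  set κ := (μ.map (splitEquiv d m)).condKernel with hκ
  set η := ((gibbs U).map (splitEquiv d m)).condKernel with hη
  have hμ : μ.map (splitEquiv d m) = μ.map (rest m) ⊗ₘ κ := by
    rw [← hfst]
    exact ((μ.map (splitEquiv d m)).disintegrate _).symm
  have hπ : (gibbs U).map (splitEquiv d m) = (gibbs U).map (rest m) ⊗ₘ η := by
    rw [← hfst]
    exact (((gibbs U).map (splitEquiv d m)).disintegrate _).symm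
  have hfin := isFiniteKernel_conditionalKernel hU m
  have hac : μ.map (rest m) ≪ (gibbs U).map (rest m) :=
    (klDiv_ne_top_iff.1 hK).1.map (measurable_rest m)
  -- The chain rule is applied with `η`, which is Markov everywhere, while the contraction
  -- hypothesis concerns the explicit conditional law. Uniqueness of disintegration identifies them
  -- almost everywhere, and `hac` transfers this to `μ`.
  have hηc : ∀ᵐ r ∂(μ.map (rest m)), conditionalKernel U m r = η r := by
    refine hac.ae_le ?_
    have := eq_condKernel_of_measure_eq_compProd (ρ := (gibbs U).map (splitEquiv d m))
      (conditionalKernel U m) (by rw [hfst]; exact gibbs_map_splitEquiv hU m)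
    rwa [hfst] at this
  have hpb : IsProbabilityMeasure (μ.bind (coordKernel m Q)) := inferInstance
  rw [← klDiv_map_measurableEquiv (splitEquiv d m) μ, hμ, hπ] at hK
  rw [← klDiv_map_measurableEquiv (splitEquiv d m) (μ.bind (coordKernel m Q)),
    ← klDiv_map_measurableEquiv (splitEquiv d m) μ,
    bind_coordKernel_map_splitEquiv m Q μ _ κ hμ, hμ, hπ]
  refine klDiv_compProd_le_of_forall κ _ η hK ?_
  filter_upwards [hηc] with r hr hlt
  -- Any value of block `m` would do in place of 0, since the full conditional does not depend on
  -- it.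
  rw [snd_compProd_apply, ← hr, conditionalKernel_apply hU m r 0] at *
  have := hβ (join m r 0) (κ r) inferInstance hlt
  rwa [rest_join] at this

theorem bind_mwgKernel (Q : ∀ m : Fin M, Kernel (Rest d m × Block d m) (Block d m))
    [∀ m, IsMarkovKernel (Q m)] (μ : Measure (State d)) :
    μ.bind (mwgKernel Q) = (M : ℝ≥0∞)⁻¹ • ∑ m, μ.bind (coordKernel m (Q m)) := by
  ext s hs
  rw [Measure.bind_apply hs (mwgKernel Q).measurable.aemeasurable]
  have e : ∀ x, mwgKernel Q x s = (M : ℝ≥0∞)⁻¹ * ∑ m, coordKernel m (Q m) x s := fun x => by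
    change ((M : ℝ≥0∞)⁻¹ • ∑ m : Fin M, coordKernel m (Q m) x) s = _
    simp
  have hm : ∀ m, Measurable fun x => coordKernel m (Q m) x s := fun m =>
    Kernel.measurable_coe _ hs
  rw [lintegral_congr e, lintegral_const_mul _ (Finset.measurable_fun_sum _ fun m _ => hm m),
    lintegral_finsetSum _ fun m _ => hm m]
  simp [Measure.bind_apply hs (coordKernel _ (Q _)).measurable.aemeasurable]

theorem klDiv_bind_mwgKernel_le {U : State d → ℝ} (hU : Measurable U) (hM : 1 ≤ M)
    [IsProbabilityMeasure (gibbs U)]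
    (Q : ∀ m : Fin M, Kernel (Rest d m × Block d m) (Block d m)) [∀ m, IsMarkovKernel (Q m)]
    {β : ℝ}
    (hβ : ∀ (m : Fin M) (x : State d) (ν : Measure (Block d m)),
      IsProbabilityMeasure ν → klDiv ν (fullConditional U m x) < ∞ →
      (klDiv (ν.bind ((Q m).sectR (rest m x))) (fullConditional U m x) : EReal) ≤
        ((1 - β : ℝ) : EReal) * (klDiv ν (fullConditional U m x) : EReal))
    (μ : Measure (State d)) [IsProbabilityMeasure μ] (hK : klDiv μ (gibbs U) ≠ ∞) :
    klDiv (μ.bind (mwgKernel Q)) (gibbs U) ≠ ∞ ∧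
      (klDiv (μ.bind (mwgKernel Q)) (gibbs U)).toReal ≤ (1 - β) * (klDiv μ (gibbs U)).toReal +
        β / M * ∑ m, (klDiv (μ.map (rest m)) ((gibbs U).map (rest m))).toReal := by
  have hM0 : (M : ℝ) ≠ 0 := by exact_mod_cast (by omega : M ≠ 0)
  have hM0' : (M : ℝ≥0∞) ≠ 0 := by exact_mod_cast (by omega : M ≠ 0)
  have hm := fun m => klDiv_bind_coordKernel_le hU m (Q m) (hβ m) μ hK
  have hp : ∀ m, IsProbabilityMeasure (μ.bind (coordKernel m (Q m))) := fun m => inferInstance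
  have key := klDiv_average_le hM (fun m => μ.bind (coordKernel m (Q m))) (gibbs U)
    fun m => (klDiv_ne_top_iff.1 (hm m).1).1
  rw [← bind_mwgKernel] at key
  have ht : (M : ℝ≥0∞)⁻¹ * ∑ m, klDiv (μ.bind (coordKernel m (Q m))) (gibbs U) ≠ ∞ :=
    ENNReal.mul_ne_top (ENNReal.inv_ne_top.2 hM0') (ENNReal.sum_ne_top.2 fun m _ => (hm m).1)
  refine ⟨ne_top_of_le_ne_top ht key, (ENNReal.toReal_mono ht key).trans ?_⟩
  rw [ENNReal.toReal_mul, ENNReal.toReal_inv, ENNReal.toReal_natCast,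
    ENNReal.toReal_sum fun m _ => (hm m).1]
  have hsum := Finset.sum_le_sum fun m (_ : m ∈ Finset.univ) => (hm m).2
  rw [Finset.sum_add_distrib, ← Finset.mul_sum _ _ β, Finset.sum_const, Finset.card_univ,
    Fintype.card_fin, nsmul_eq_mul] at hsum
  calc (M : ℝ)⁻¹ * ∑ m, (klDiv (μ.bind (coordKernel m (Q m))) (gibbs U)).toReal
      ≤ (M : ℝ)⁻¹ * (M * ((1 - β) * (klDiv μ (gibbs U)).toReal) +
        β * ∑ m, (klDiv (μ.map (rest m)) ((gibbs U).map (rest m))).toReal) := by gcongr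
    _ = _ := by field_simp

theorem measure_univ_fullConditional_le_one (U : State d → ℝ) (m : Fin M) (x : State d) :
    fullConditional U m x Set.univ ≤ 1 := by
  rw [fullConditional, Measure.smul_apply, withDensity_apply _ MeasurableSet.univ,
    Measure.restrict_univ, smul_eq_mul]
  exact ENNReal.inv_mul_le_one _

/-- Reversible conditional updates do not increase the divergence. -/
theorem klDiv_bind_sectR_le (U : State d → ℝ) (m : Fin M)
    (Q : Kernel (Rest d m × Block d m) (Block d m)) [IsMarkovKernel Q] (x : State d)
    (hrev : (Q.sectR (rest m x)).IsReversible (fullConditional U m x))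
    (ν : Measure (Block d m)) [IsProbabilityMeasure ν] :
    klDiv (ν.bind (Q.sectR (rest m x))) (fullConditional U m x) ≤
      klDiv ν (fullConditional U m x) := by
  have : IsFiniteMeasure (fullConditional U m x) :=
    ⟨(measure_univ_fullConditional_le_one U m x).trans_lt ENNReal.one_lt_top⟩
  have h := klDiv_comp_right_le ν (fullConditional U m x) (Q.sectR (rest m x))
  rwa [hrev.invariant.def] at h

theorem coe_le_coe_mul_of_toReal_le {a b : ℝ≥0∞} (ha : a ≠ ∞) (hb : b ≠ ∞) {c : ℝ}
    (h : a.toReal ≤ c * b.toReal) : (a : EReal) ≤ (c : EReal) * (b : EReal) := by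
  lift a to NNReal using ha
  lift b to NNReal using hb
  have : (((a : ℝ) : ℝ) : EReal) ≤ ((c * (b : ℝ) : ℝ) : EReal) := EReal.coe_le_coe_iff.2 h
  rwa [EReal.coe_mul] at this

end MwG

/-! ### The contraction estimate -/

theorem mainTheorem6 {M : ℕ} (hM : 1 ≤ M) (d : Fin M → ℕ)
    (U U₀ : MwG.State d → ℝ) (V : ∀ m, MwG.Block d m → ℝ) (L : Fin M → ℝ)
    (lamStar kappaStar : ℝ) (hU : MwG.BlockConvexSmooth U U₀ V L lamStar)
    (hkappa : kappaStar = 1 / lamStar)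
    (hπ : IsProbabilityMeasure (MwG.gibbs U))
    (Q : ∀ m : Fin M, Kernel (MwG.Rest d m × MwG.Block d m) (MwG.Block d m))
    [∀ m, IsMarkovKernel (Q m)]
    (hrev : ∀ (m : Fin M) (x : MwG.State d),
      ((Q m).sectR (MwG.rest m x)).IsReversible (MwG.fullConditional U m x))
    (β : ℝ)
    (hβ : ∀ (m : Fin M) (x : MwG.State d) (ν : Measure (MwG.Block d m)),
      IsProbabilityMeasure ν → klDiv ν (MwG.fullConditional U m x) < ∞ →
      (klDiv (ν.bind ((Q m).sectR (MwG.rest m x))) (MwG.fullConditional U m x) : EReal) ≤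
        ((1 - β : ℝ) : EReal) * (klDiv ν (MwG.fullConditional U m x) : EReal))
    (μ : Measure (MwG.State d)) (hμ : IsProbabilityMeasure μ)
    (hKL : klDiv μ (MwG.gibbs U) < ∞) :
    (klDiv (μ.bind (MwG.mwgKernel Q)) (MwG.gibbs U) : EReal) ≤
      ((1 - β / (kappaStar * M) : ℝ) : EReal) * (klDiv μ (MwG.gibbs U) : EReal) := by
  have hM0 : (0 : ℝ) < M := by exact_mod_cast (by omega : 0 < M)
  have hlam := hU.lam_pos
  have hc : β / (kappaStar * M) = β * lamStar / M := by
    rw [hkappa]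
    field_simp
  rw [hc]
  have hUm := hU.continuous.measurable
  rcases le_or_gt 0 β with h0 | h0
  · obtain ⟨h1, h2⟩ := MwG.klDiv_bind_mwgKernel_le hUm hM Q hβ μ hKL.ne
    refine MwG.coe_le_coe_mul_of_toReal_le h1 hKL.ne (h2.trans ?_)
    have h3 := mul_le_mul_of_nonneg_left (MwG.sum_klDiv_rest_le hU hM μ hKL.ne)
      (div_nonneg h0 hM0.le)
    refine (add_le_add_right h3 _).trans_eq ?_
    field_simp
    ring
  -- For negative `β` an upper bound on the marginal divergences is useless. Reversibility gives
  -- contraction with constant 1, and the target constant is at least 1.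
  · obtain ⟨h1, h2⟩ := MwG.klDiv_bind_mwgKernel_le (β := 0) hUm hM Q (fun m x ν hν _ => by
      simpa using MwG.klDiv_bind_sectR_le U m (Q m) x (hrev m x) ν) μ hKL.ne
    refine MwG.coe_le_coe_mul_of_toReal_le h1 hKL.ne (h2.trans ?_)
    have h3 : β * lamStar / M ≤ 0 :=
      div_nonpos_of_nonpos_of_nonneg (mul_nonpos_of_nonpos_of_nonneg h0.le hlam.le) hM0.le
    have h4 : 0 ≤ (klDiv μ (MwG.gibbs U)).toReal := ENNReal.toReal_nonneg
    simp only [sub_zero, one_mul, zero_div, zero_mul, add_zero]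
    nlinarith
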